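/- Let $T>0$, let $(\Omega,\mathcal F,P)$ be a probability space with a right-continuous filtration $(\mathcal F_t)_{0\le t\le T}$, $\mathcal F_T=\mathcal F$. Write $L_\infty(\mathcal F_t)=L_\infty(\Omega,\mathcal F_t,P)$, and $L_\infty^+(\mathcal F_t)$ for its cone of non-negative elements. (In)equalities between random variables are meant $P$-a.s.; $X>Y$ between elements of $L_\infty$ means $X\ge Y$ $P$-a.s. and $P(X>Y)>0$. "$u_n\downarrow u$" means that $(u_n)$ is a non-increasing sequence in $[0,T]$ with $u_n>u$ and $u_n\to u$. An operator $A$ is called $\mathcal F_s$-homogeneous if $A(\lambda X)=\lambda A(X)$ for all $X$ in its domain and all $\lambda\in L^+_\infty(\mathcal F_s)$ such that $\lambda X$ is in the domain. **Majorants and minorants.** For $0\le s\le t\le T$ let $M_{st},m_{st}:L^+_\infty(\mathcal F_t)\to L^+_\infty(\mathcal F_s)$ be $\mathcal F_s$-homogeneous, with $M_{st}$ sublinear ($M_{st}(X+Y)\le M_{st}(X)+M_{st}(Y)$, $M_{st}(cX)=cM_{st}(X)$ for real $c\ge0$) and $m_{st}$ superlinear ($m_{st}(X+Y)\ge m_{st}(X)+m_{st}(Y)$,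 $m_{st}(cX)=c\,m_{st}(X)$ for real $c\ge 0$). Assume: 1. (weak time-consistency) for all $r\le s\le t$ and $X\in L_\infty^+(\mathcal F_t)$, $M_{rs}(M_{st}(X))\le M_{rt}(X)$ and $m_{rs}(m_{st}(X))\ge m_{rt}(X)$; moreover, whenever $t_n\downarrow t$, $M_{st_n}(X)\to M_{st}(X)$ and $m_{st_n}(X)\to m_{st}(X)$ $P$-a.s.; 2. each $M_{st}$ is regular (if $X_n\in L_\infty^+(\mathcal F_t)$ is non-increasing with $X_n\downarrow 0$ $P$-a.s., then $M_{st}(X_n)\to0$ $P$-a.s.) or weak* continuous (continuous from $\sigma(L_\infty(\mathcal F_t),L_1(\mathcal F_t))$ to $\sigma(L_\infty(\mathcal F_s),L_1(\mathcal F_s))$ on the respective cones); 3. $m_{0T}(X)>0$ for every $X\in L_\infty^+(\mathcal F_T)$ with $X>0$; 4. for all $s\le t$, $X\in L_\infty^+(\mathcal F_t)$ and all $s_n\downarrow s$ with $s_n\le t$, $P$-a.s., $M_{st}(X)\ge\liminf_n M_{s_nt}(X)$ and $m_{st}(X)\le\limsup_n m_{s_nt}(X)$. **Prices.** For every $t\in[0,T]$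 let $L_t\subseteq L_\infty(\mathcal F_t)$ be a linear subspace with $1\in L_t$ and $L_t\subseteq L_T$. For $s\le t$ let $x_{st}:L_t\to L_s$ be a price operator: monotone, strictly monotone ($X'>X''$ implies $x_{st}(X')>x_{st}(X'')$), additive, $\mathcal F_s$-homogeneous, and with $x_{st}(1)=1$. Assume that the family is time-consistent, $x_{st}(X)=x_{sr}(x_{rt}(X))$ for $s\le r\le t$ and $X\in L_t$, and right-continuous, $x_{s_nt}(X)\to x_{st}(X)$ $P$-a.s. whenever $X\in L_t$, $s_n\downarrow s$ and $s_n\le t$. Assume finally the sandwich condition: for all $s\le t$, $$m_{st}(Z)+x_{st}(X)\le M_{st}(Y)\qquad\text{for all }X\in L_t,\ Y,Z\in L_\infty^+(\mathcal F_t)\text{ with }Z+X\le Y.$$ **Conclusion.** There are a probability measure $P_0\sim P$ on $\mathcal F$ and an $f\in L_1^+(\mathcal F)$ with $E[f\,|\,\mathcal F_0]=1$ and $P_0(A)=\int_A f\,dP$ for all $A\in\mathcal F$, such that for all $0\le s\le t\le T$ $$m_{st}(X)\le E_{P_0}[X\,|\,\mathcal F_s]\le M_{st}(X),\qquad X\in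 L_\infty^+(\mathcal F_t),$$ and $$x_{st}(X)=E_{P_0}[X\,|\,\mathcal F_s]=E\Big[X\,\frac{f}{E[f|\mathcal F_s]}\,\Big|\,\mathcal F_s\Big],\qquad X\in L_t,$$ where the variable under the last conditional expectation is $P$-integrable. -/

import Mathlib

open MeasureTheory Filter Topology
open scoped ENNReal

namespace SandwichPricing

noncomputable section

/-- `L_∞(Ω, 𝒜, P)`, realised as the subspace of `L_∞(Ω, ℱ, P)` of all classes that have an
`𝒜`-measurable representative. -/
abbrev Linf {Ω : Type*} (𝒜 : MeasurableSpace Ω) {mΩ : MeasurableSpace Ω} (P : Measure Ω) :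
    Submodule ℝ (Lp ℝ ∞ P) :=
  lpMeas ℝ ℝ 𝒜 ∞ P

/-- The cone `L_∞⁺(Ω, 𝒜, P)` of the non-negative elements of `L_∞(Ω, 𝒜, P)`. -/
def LinfPos {Ω : Type*} (𝒜 : MeasurableSpace Ω) {mΩ : MeasurableSpace Ω} (P : Measure Ω) :
    Set (Lp ℝ ∞ P) :=
  {X | X ∈ Linf 𝒜 P ∧ 0 ≤ X}

/-- The constant `1` in `L_∞`. -/
def one {Ω : Type*} {mΩ : MeasurableSpace Ω} (P : Measure Ω) [IsFiniteMeasure P] : Lp ℝ ∞ P :=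
  Lp.const ∞ P (1 : ℝ)

/-- The (almost everywhere) pointwise product of two elements of `L_∞`. -/
def mul {Ω : Type*} {mΩ : MeasurableSpace Ω} {P : Measure Ω} (X Y : Lp ℝ ∞ P) : Lp ℝ ∞ P :=
  X • Y

theorem coeFn_mul {Ω : Type*} {mΩ : MeasurableSpace Ω} {P : Measure Ω} (X Y : Lp ℝ ∞ P) :
    ⇑(mul X Y) =ᵐ[P] fun ω => X ω * Y ω := by
  have h : ⇑(mul X Y) =ᵐ[P] ⇑X • ⇑Y := Lp.coeFn_lpSMul (r := ∞) X Y
  filter_upwards [h] with ω hω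
  simpa using hω

/-! ### Properties of single operators

An operator on a subset `D` of `L_∞` (a cone `L_∞⁺(ℬ)` or a subspace `L`) is given by a total map
of `L_∞` into itself, of which only the values on `D` are used. -/

/-- `𝒜`-homogeneity on the domain `D`: `M (λ X) = λ M X` for all `X ∈ D` and `λ ∈ L_∞⁺(𝒜)` such
that `λ X ∈ D`. -/
def IsHomogeneous {Ω : Type*} (𝒜 : MeasurableSpace Ω) {mΩ : MeasurableSpace Ω} {P : Measure Ω}
    (D : Set (Lp ℝ ∞ P)) (M : Lp ℝ ∞ P → Lp ℝ ∞ P) : Prop :=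
  ∀ X ∈ D, ∀ l ∈ LinfPos 𝒜 P, mul l X ∈ D → M (mul l X) = mul l (M X)

/-- Sublinearity of `M` on `L_∞⁺(ℬ)`. -/
structure IsSublinear {Ω : Type*} (ℬ : MeasurableSpace Ω) {mΩ : MeasurableSpace Ω}
    {P : Measure Ω} (M : Lp ℝ ∞ P → Lp ℝ ∞ P) : Prop where
  map_add_le : ∀ X ∈ LinfPos ℬ P, ∀ Y ∈ LinfPos ℬ P, M (X + Y) ≤ M X + M Y
  map_smul : ∀ X ∈ LinfPos ℬ P, ∀ c : ℝ, 0 ≤ c → M (c • X) = c • M X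

/-- Superlinearity of `m` on `L_∞⁺(ℬ)`. -/
structure IsSuperlinear {Ω : Type*} (ℬ : MeasurableSpace Ω) {mΩ : MeasurableSpace Ω}
    {P : Measure Ω} (m : Lp ℝ ∞ P → Lp ℝ ∞ P) : Prop where
  le_map_add : ∀ X ∈ LinfPos ℬ P, ∀ Y ∈ LinfPos ℬ P, m X + m Y ≤ m (X + Y)
  map_smul : ∀ X ∈ LinfPos ℬ P, ∀ c : ℝ, 0 ≤ c → m (c • X) = c • m X

/-- `M` is regular on `L_∞⁺(ℬ)`: if `X n ↓ 0` almost surely, then `M (X n) → 0` almost surely. -/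
def IsRegular {Ω : Type*} (ℬ : MeasurableSpace Ω) {mΩ : MeasurableSpace Ω} {P : Measure Ω}
    (M : Lp ℝ ∞ P → Lp ℝ ∞ P) : Prop :=
  ∀ X : ℕ → Lp ℝ ∞ P, (∀ n, X n ∈ LinfPos ℬ P) → Antitone X →
    (∀ᵐ ω ∂P, Tendsto (fun n => X n ω) atTop (𝓝 0)) →
    ∀ᵐ ω ∂P, Tendsto (fun n => M (X n) ω) atTop (𝓝 0)

/-- The coarsest topology that makes `X ↦ E[f X]` continuous for every `f ∈ L¹(Ω, 𝒜, P)`.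
On the subspace `L_∞(𝒜)` it induces the weak* topology `σ(L_∞(𝒜), L¹(𝒜))`. -/
@[reducible] def weakStar {Ω : Type*} (𝒜 : MeasurableSpace Ω) {mΩ : MeasurableSpace Ω} (P : Measure Ω) :
    TopologicalSpace (Lp ℝ ∞ P) :=
  ⨅ f : lpMeas ℝ ℝ 𝒜 1 P,
    TopologicalSpace.induced (fun X : Lp ℝ ∞ P => ∫ ω, (f : Lp ℝ 1 P) ω * X ω ∂P) inferInstance

/-- `M : L_∞⁺(ℬ) → L_∞⁺(𝒜)` is weak* continuous: continuous when `L_∞⁺(ℬ)` carries the topology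
induced by `σ(L_∞(ℬ), L¹(ℬ))` and `L_∞⁺(𝒜)` the one induced by `σ(L_∞(𝒜), L¹(𝒜))`. -/
def IsWeakStarContinuous {Ω : Type*} (𝒜 ℬ : MeasurableSpace Ω) {mΩ : MeasurableSpace Ω}
    {P : Measure Ω} (M : Lp ℝ ∞ P → Lp ℝ ∞ P) : Prop :=
  @ContinuousOn _ _ (weakStar ℬ P) (weakStar 𝒜 P) M (LinfPos ℬ P)

/-- `x : L → L_∞(𝒜)` is a price operator on the linear subspace `L` of `L_∞`. The relation `<` of
`Lp` is `≤` almost surely together with `<` on a set of positive measure. -/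
structure IsPriceOperator {Ω : Type*} (𝒜 : MeasurableSpace Ω) {mΩ : MeasurableSpace Ω}
    {P : Measure Ω} [IsFiniteMeasure P] (L : Submodule ℝ (Lp ℝ ∞ P))
    (x : Lp ℝ ∞ P → Lp ℝ ∞ P) : Prop where
  maps_to : ∀ X ∈ L, x X ∈ Linf 𝒜 P
  mono : ∀ X ∈ L, ∀ Y ∈ L, X ≤ Y → x X ≤ x Y
  strict_mono : ∀ X ∈ L, ∀ Y ∈ L, X < Y → x X < x Y
  map_add : ∀ X ∈ L, ∀ Y ∈ L, x (X + Y) = x X + x Y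
  homogeneous : IsHomogeneous 𝒜 (L : Set (Lp ℝ ∞ P)) x
  map_one : x (one P) = one P

/-! ### Families indexed by `0 ≤ s ≤ t ≤ T` -/

/-- The sequence `u` decreases to `s` through values strictly larger than `s`. -/
def DecreasesTo {T : ℝ} (u : ℕ → Set.Icc (0 : ℝ) T) (s : Set.Icc (0 : ℝ) T) : Prop :=
  Antitone u ∧ (∀ n, s < u n) ∧ Tendsto u atTop (𝓝 s)

section Families

variable {Ω : Type*} {mΩ : MeasurableSpace Ω} {T : ℝ}

/-- A weak time-consistent family of `ℱ_s`-homogeneous sublinear operators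
`M s t : L_∞⁺(ℱ_t) → L_∞⁺(ℱ_s)`, `s ≤ t`. -/
structure IsWeakConsistentSublinear (P : Measure Ω) (𝓕 : Filtration (Set.Icc (0 : ℝ) T) mΩ)
    (M : Set.Icc (0 : ℝ) T → Set.Icc (0 : ℝ) T → Lp ℝ ∞ P → Lp ℝ ∞ P) : Prop where
  maps_to : ∀ s t, s ≤ t → Set.MapsTo (M s t) (LinfPos (𝓕 t) P) (LinfPos (𝓕 s) P)
  sublinear : ∀ s t, s ≤ t → IsSublinear (𝓕 t) (M s t)
  homogeneous : ∀ s t, s ≤ t → IsHomogeneous (𝓕 s) (LinfPos (𝓕 t) P) (M s t)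
  comp_le : ∀ r s t, r ≤ s → s ≤ t → ∀ X ∈ LinfPos (𝓕 t) P, M r s (M s t X) ≤ M r t X
  right_limit : ∀ s t, s ≤ t → ∀ X ∈ LinfPos (𝓕 t) P, ∀ u, DecreasesTo u t →
    ∀ᵐ ω ∂P, Tendsto (fun n => M s (u n) X ω) atTop (𝓝 (M s t X ω))

/-- A weak time-consistent family of `ℱ_s`-homogeneous superlinear operators
`m s t : L_∞⁺(ℱ_t) → L_∞⁺(ℱ_s)`, `s ≤ t`. -/
structure IsWeakConsistentSuperlinear (P : Measure Ω) (𝓕 : Filtration (Set.Icc (0 : ℝ) T) mΩ)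
    (m : Set.Icc (0 : ℝ) T → Set.Icc (0 : ℝ) T → Lp ℝ ∞ P → Lp ℝ ∞ P) : Prop where
  maps_to : ∀ s t, s ≤ t → Set.MapsTo (m s t) (LinfPos (𝓕 t) P) (LinfPos (𝓕 s) P)
  superlinear : ∀ s t, s ≤ t → IsSuperlinear (𝓕 t) (m s t)
  homogeneous : ∀ s t, s ≤ t → IsHomogeneous (𝓕 s) (LinfPos (𝓕 t) P) (m s t)
  le_comp : ∀ r s t, r ≤ s → s ≤ t → ∀ X ∈ LinfPos (𝓕 t) P, m r t X ≤ m r s (m s t X)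
  right_limit : ∀ s t, s ≤ t → ∀ X ∈ LinfPos (𝓕 t) P, ∀ u, DecreasesTo u t →
    ∀ᵐ ω ∂P, Tendsto (fun n => m s (u n) X ω) atTop (𝓝 (m s t X ω))

/-- The spaces of marketed claims: linear subspaces `L t ⊆ L_∞(ℱ_t)` that contain the numéraire
`1` and satisfy `L t ⊆ L T`. -/
structure IsMarket (P : Measure Ω) [IsFiniteMeasure P] (𝓕 : Filtration (Set.Icc (0 : ℝ) T) mΩ)
    (L : Set.Icc (0 : ℝ) T → Submodule ℝ (Lp ℝ ∞ P)) : Prop where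
  le_Linf : ∀ t, L t ≤ Linf (𝓕 t) P
  one_mem : ∀ t, one P ∈ L t
  le_terminal : ∀ t t' : Set.Icc (0 : ℝ) T, (t' : ℝ) = T → L t ≤ L t'

/-- A time-consistent, right-continuous family of price operators `x s t : L t → L s`, `s ≤ t`. -/
structure IsPriceFamily (P : Measure Ω) [IsFiniteMeasure P]
    (𝓕 : Filtration (Set.Icc (0 : ℝ) T) mΩ)
    (L : Set.Icc (0 : ℝ) T → Submodule ℝ (Lp ℝ ∞ P))
    (x : Set.Icc (0 : ℝ) T → Set.Icc (0 : ℝ) T → Lp ℝ ∞ P → Lp ℝ ∞ P) : Prop where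
  price : ∀ s t, s ≤ t → IsPriceOperator (𝓕 s) (L t) (x s t)
  maps_to : ∀ s t, s ≤ t → ∀ X ∈ L t, x s t X ∈ L s
  consistent : ∀ s r t, s ≤ r → r ≤ t → ∀ X ∈ L t, x s t X = x s r (x r t X)
  right_continuous : ∀ s t, s ≤ t → ∀ X ∈ L t, ∀ u, DecreasesTo u s → (∀ n, u n ≤ t) →
    ∀ᵐ ω ∂P, Tendsto (fun n => x (u n) t X ω) atTop (𝓝 (x s t X ω))

end Families

end

end SandwichPricing

/-!
The measure `P₀` is obtained from a linear functional `φ` on `L_∞`, thought of as `E_{P₀}`. By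
homogeneity of `m`, `M` and by testing with indicators of sets in `ℱ_s`, the claim about `P₀`
becomes: `φ = E_P` on `L_∞(ℱ_0)`, and for all `s ≤ t`

* `φ (m_{st} X) ≤ φ X ≤ φ (M_{st} X)` for `X ∈ L_∞⁺(ℱ_t)`,
* `φ (1_A X) = φ (1_A x_{st} X)` for `X ∈ L_t`, `A ∈ ℱ_s`.

These conditions (`IsCompatible`) are linear in `φ` and closed under pointwise limits, so by
compactness it suffices to satisfy them for finitely many times (`exists_isCompatible`). For
finitely many times, `φ` is extended from each time to the next (`IsSandwich.exists_extension`), and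
weak time-consistency of `m` and `M` gives the bounds over several steps
(`exists_isCompatible_finset`). A single step is an application of the M. Riesz extension theorem.
It needs the sandwich condition not only for `X ∈ L_t` but also for claims pasted together from
elements of `L_t` along a finite `ℱ_s`-measurable partition; this follows from homogeneity
(`IsSandwich.sandwich_local`).

Finally `φ ≤ φ ∘ M_{0T} = E_P ∘ M_{0T}` on `L_∞⁺`, and regularity or weak* continuity of `M_{0T}`
makes `φ` countably additive (`IsRegular.tendsto_map_zero`, `IsWeakStarContinuous.tendsto_map_zero`,
`exists_measure_eq_integral`). Strict positivity of `m_{0T}` gives `P ≪ P₀`, and the formula with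
the density `f = dP₀/dP` is Bayes' formula (`condExp_eq_condExp_mul_div`).
-/

namespace SandwichPricing

noncomputable section

section

variable {Ω : Type*} {𝒜 ℬ : MeasurableSpace Ω} {mΩ : MeasurableSpace Ω} {P : Measure Ω}

/-! ### Elements of `L_∞` -/

theorem mul_neg_right (l X : Lp ℝ ∞ P) : mul l (-X) = -mul l X := by
  refine Lp.ext ?_
  filter_upwards [coeFn_mul l (-X), coeFn_mul l X, Lp.coeFn_neg X, Lp.coeFn_neg (mul l X)]
    with ω h₁ h₂ h₃ h₄
  rw [h₁, h₄, Pi.neg_apply, h₂, h₃, Pi.neg_apply, mul_neg]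

theorem ae_abs_le_norm (X : Lp ℝ ∞ P) : ∀ᵐ ω ∂P, |X ω| ≤ ‖X‖ := by
  have h := ae_le_lpNorm_exponent_top (Lp.memLp X)
  have h' : lpNorm X ∞ P = ‖X‖ := by
    rw [Lp.norm_def, toReal_eLpNorm (Lp.aestronglyMeasurable X)]
  filter_upwards [h] with ω hω
  rwa [h'] at hω

theorem mem_Linf {X : Lp ℝ ∞ P} : X ∈ Linf 𝒜 P ↔ AEStronglyMeasurable[𝒜] X P :=
  mem_lpMeas_iff_aestronglyMeasurable

theorem Linf_mono (h : 𝒜 ≤ ℬ) : Linf 𝒜 P ≤ Linf ℬ P := fun _ hX =>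
  mem_Linf.2 ((mem_Linf.1 hX).mono h)

theorem LinfPos_mono (h : 𝒜 ≤ ℬ) : LinfPos 𝒜 P ⊆ LinfPos ℬ P := fun _ hX =>
  ⟨Linf_mono h hX.1, hX.2⟩

theorem mem_LinfPos_top {X : Lp ℝ ∞ P} (h : 0 ≤ X) : X ∈ LinfPos mΩ P :=
  ⟨mem_Linf.2 (Lp.aestronglyMeasurable X), h⟩

theorem mem_LinfPos_zero : (0 : Lp ℝ ∞ P) ∈ LinfPos 𝒜 P := ⟨zero_mem _, le_rfl⟩

theorem mem_LinfPos_add {X Y : Lp ℝ ∞ P} (hX : X ∈ LinfPos 𝒜 P) (hY : Y ∈ LinfPos 𝒜 P) :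
    X + Y ∈ LinfPos 𝒜 P := ⟨add_mem hX.1 hY.1, add_nonneg hX.2 hY.2⟩

theorem smul_le_smul_Linf {X Y : Lp ℝ ∞ P} {c : ℝ} (hc : 0 ≤ c) (h : X ≤ Y) :
    c • X ≤ c • Y := by
  rw [← Lp.coeFn_le] at h ⊢
  filter_upwards [h, Lp.coeFn_smul c X, Lp.coeFn_smul c Y] with ω h₁ h₂ h₃
  simpa [h₂, h₃] using mul_le_mul_of_nonneg_left h₁ hc

theorem mem_LinfPos_smul {X : Lp ℝ ∞ P} {c : ℝ} (hc : 0 ≤ c) (hX : X ∈ LinfPos 𝒜 P) :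
    c • X ∈ LinfPos 𝒜 P :=
  ⟨Submodule.smul_mem _ _ hX.1, by simpa using smul_le_smul_Linf hc hX.2⟩

theorem mul_mem_Linf {X Y : Lp ℝ ∞ P} (hX : X ∈ Linf 𝒜 P) (hY : Y ∈ Linf 𝒜 P) :
    mul X Y ∈ Linf 𝒜 P :=
  mem_Linf.2 (((mem_Linf.1 hX).mul (mem_Linf.1 hY)).congr (coeFn_mul X Y).symm)

theorem mul_nonneg_Linf {X Y : Lp ℝ ∞ P} (hX : 0 ≤ X) (hY : 0 ≤ Y) : 0 ≤ mul X Y := by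
  rw [← Lp.coeFn_nonneg] at *
  filter_upwards [hX, hY, coeFn_mul X Y] with ω h₁ h₂ h₃
  rw [h₃]
  exact mul_nonneg h₁ h₂

theorem mul_mem_LinfPos {X Y : Lp ℝ ∞ P} (hX : X ∈ LinfPos 𝒜 P) (hY : Y ∈ LinfPos 𝒜 P) :
    mul X Y ∈ LinfPos 𝒜 P := ⟨mul_mem_Linf hX.1 hY.1, mul_nonneg_Linf hX.2 hY.2⟩

theorem map_le_map {φ : Lp ℝ ∞ P →ₗ[ℝ] ℝ} (hφ : ∀ X ∈ LinfPos 𝒜 P, 0 ≤ φ X)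
    {X Y : Lp ℝ ∞ P} (hX : X ∈ Linf 𝒜 P)
    (hY : Y ∈ Linf 𝒜 P) (h : X ≤ Y) : φ X ≤ φ Y := by
  have := hφ (Y - X) ⟨sub_mem hY hX, sub_nonneg.2 h⟩
  rw [map_sub] at this
  linarith

theorem integrable_coeFn (X : Lp ℝ ∞ P) {μ : Measure Ω} [IsFiniteMeasure μ] (hμ : μ ≪ P) :
    Integrable X μ := by
  refine Integrable.of_bound ((Lp.aestronglyMeasurable X).mono_ac hμ) ‖X‖ ?_
  filter_upwards [hμ.ae_le (ae_abs_le_norm X)] with ω h using h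

variable [IsProbabilityMeasure P]

/-- The class of the indicator function of `A` in `L_∞`. -/
def ind (P : Measure Ω) [IsProbabilityMeasure P] {A : Set Ω} (hA : MeasurableSet A) :
    Lp ℝ ∞ P :=
  indicatorConstLp ∞ hA (measure_ne_top P A) (1 : ℝ)

theorem coeFn_ind {A : Set Ω} (hA : MeasurableSet A) :
    ⇑(ind P hA) =ᵐ[P] A.indicator fun _ => 1 :=
  indicatorConstLp_coeFn

theorem coeFn_one : ⇑(one P) =ᵐ[P] fun _ => 1 :=
  Lp.coeFn_const ∞ P (1 : ℝ)

theorem coeFn_ind_mul {A : Set Ω} (hA : MeasurableSet A) (X : Lp ℝ ∞ P) :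
    ⇑(mul (ind P hA) X) =ᵐ[P] A.indicator X := by
  filter_upwards [coeFn_mul (ind P hA) X, coeFn_ind (P := P) hA] with ω h₁ h₂
  by_cases h : ω ∈ A <;> simp [h₁, h₂, h]

theorem mul_one_right (l : Lp ℝ ∞ P) : mul l (one P) = l := by
  refine Lp.ext ?_
  filter_upwards [coeFn_mul l (one P), coeFn_one (P := P)] with ω h₁ h₂
  simp [h₁, h₂]

theorem smul_one_mul (c : ℝ) (X : Lp ℝ ∞ P) : mul (c • one P) X = c • X := by
  refine Lp.ext ?_
  filter_upwards [coeFn_mul (c • one P) X, coeFn_one (P := P), Lp.coeFn_smul c (one P),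
    Lp.coeFn_smul c X] with ω h₁ h₂ h₃ h₄
  simp [h₁, h₂, h₃, h₄]

theorem le_norm_smul_one (X : Lp ℝ ∞ P) : X ≤ ‖X‖ • one P := by
  rw [← Lp.coeFn_le]
  filter_upwards [ae_abs_le_norm X, coeFn_one (P := P), Lp.coeFn_smul ‖X‖ (one P)] with ω h₁ h₂ h₃
  simpa [h₃, h₂] using (le_abs_self _).trans h₁

theorem one_nonneg : 0 ≤ one P := by
  rw [← Lp.coeFn_nonneg]
  filter_upwards [coeFn_one (P := P)] with ω h
  simp [h]

theorem one_mem_LinfPos : one P ∈ LinfPos 𝒜 P :=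
  ⟨mem_Linf.2 (aestronglyMeasurable_const.congr (coeFn_one (P := P)).symm), one_nonneg⟩

theorem ind_nonneg {A : Set Ω} (hA : MeasurableSet A) : 0 ≤ ind P hA := by
  rw [← Lp.coeFn_nonneg]
  filter_upwards [coeFn_ind (P := P) hA] with ω h
  rw [h]
  exact Set.indicator_nonneg (fun _ _ => zero_le_one) _

theorem ind_mem_LinfPos (h : 𝒜 ≤ mΩ) {A : Set Ω} (hA : MeasurableSet[𝒜] A) :
    ind P (h A hA) ∈ LinfPos 𝒜 P :=
  ⟨mem_Linf.2 (((@stronglyMeasurable_const _ _ 𝒜 _ (1 : ℝ)).indicator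
    hA).aestronglyMeasurable.congr (coeFn_ind (P := P) (h A hA)).symm), ind_nonneg _⟩

theorem ind_empty : ind P MeasurableSet.empty = 0 := by
  simp [ind]

theorem ind_union {A B : Set Ω} (hA : MeasurableSet A) (hB : MeasurableSet B)
    (h : Disjoint A B) : ind P (hA.union hB) = ind P hA + ind P hB := by
  refine Lp.ext ?_
  filter_upwards [coeFn_ind (P := P) (hA.union hB), coeFn_ind (P := P) hA, coeFn_ind (P := P) hB,
    Lp.coeFn_add (ind P hA) (ind P hB)] with ω h₁ h₂ h₃ h₄
  rw [h₁, h₄, Pi.add_apply, h₂, h₃, Set.indicator_union_of_disjoint h]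

/-! ### Positive functionals on `L_∞` -/

section Functionals

variable {φ φ₁ φ₂ : Lp ℝ ∞ P →ₗ[ℝ] ℝ}

theorem abs_map_le (hφ : ∀ X ∈ LinfPos 𝒜 P, 0 ≤ φ X) {X : Lp ℝ ∞ P} (hX : X ∈ Linf 𝒜 P) :
    |φ X| ≤ ‖X‖ * φ (one P) := by
  have h1 : ‖X‖ • one P ∈ Linf 𝒜 P := Submodule.smul_mem _ _ one_mem_LinfPos.1
  have h2 := map_le_map hφ hX h1 (le_norm_smul_one X)
  have h3 := map_le_map hφ (neg_mem hX) h1 (by simpa using le_norm_smul_one (-X))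
  rw [map_smul, smul_eq_mul] at h2 h3
  rw [map_neg] at h3
  exact abs_le.2 ⟨by linarith, h2⟩

/-- A linear functional that vanishes on the indicators of the sets in `𝒜` and is bounded on the
order interval `[0, 1]` of `L_∞(𝒜)` is small there: `X ∈ [0, 1]` differs by half an element of
`[0, 1]` from half the indicator of `{1/2 ≤ X}`. -/
theorem abs_map_le_pow (h𝒜 : 𝒜 ≤ mΩ)
    (h_ind : ∀ A (hA : MeasurableSet[𝒜] A), φ (ind P (h𝒜 A hA)) = 0) {C : ℝ}
    (hC : ∀ X ∈ LinfPos 𝒜 P, X ≤ one P → |φ X| ≤ C) (n : ℕ) :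
    ∀ X ∈ LinfPos 𝒜 P, X ≤ one P → |φ X| ≤ (1 / 2) ^ n * C := by
  induction n with
  | zero => simpa using hC
  | succ n ih =>
    intro X hX hX1
    obtain ⟨g, hg, hXg⟩ := mem_Linf.1 hX.1
    have hA : MeasurableSet[𝒜] {ω | 1 / 2 ≤ g ω} :=
      hg.measurable measurableSet_Ici
    set I := ind P (h𝒜 _ hA)
    have hae : ∀ᵐ ω ∂P, ((2 : ℝ) • X - I) ω = 2 * X ω - if 1 / 2 ≤ X ω then 1 else 0 := by
      filter_upwards [hXg, Lp.coeFn_sub ((2 : ℝ) • X) I, Lp.coeFn_smul (2 : ℝ) X,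
        coeFn_ind (P := P) (h𝒜 _ hA)] with ω h₁ h₂ h₃ h₄
      simp only [h₂, Pi.sub_apply, h₃, I, h₄, Set.indicator, Set.mem_ofPred_eq, h₁, Pi.smul_apply,
        smul_eq_mul]
    have h0 := (Lp.coeFn_nonneg X).2 hX.2
    have h1 := (Lp.coeFn_le X (one P)).2 hX1
    have hX' : (2 : ℝ) • X - I ∈ LinfPos 𝒜 P := by
      refine ⟨sub_mem (Submodule.smul_mem _ _ hX.1) (ind_mem_LinfPos h𝒜 hA).1, ?_⟩
      rw [← Lp.coeFn_nonneg]
      filter_upwards [hae, h0] with ω h₁ h₂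
      simp only [Pi.zero_apply] at h₂ ⊢
      rw [h₁]
      split_ifs <;> linarith
    have hX'1 : (2 : ℝ) • X - I ≤ one P := by
      rw [← Lp.coeFn_le]
      filter_upwards [hae, h1, coeFn_one (P := P)] with ω h₁ h₂ h₃
      rw [h₃] at h₂ ⊢
      rw [h₁]
      split_ifs <;> linarith
    have h := ih _ hX' hX'1
    rw [map_sub, map_smul, h_ind _ hA, sub_zero, smul_eq_mul, abs_mul, abs_two] at h
    rw [pow_succ]
    linarith

/-- Positive functionals on `L_∞(𝒜)` are determined by their values on indicators. -/
theorem map_eq_of_map_ind_eq (h𝒜 : 𝒜 ≤ mΩ) (h₁ : ∀ X ∈ LinfPos 𝒜 P, 0 ≤ φ₁ X)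
    (h₂ : ∀ X ∈ LinfPos 𝒜 P, 0 ≤ φ₂ X)
    (h_ind : ∀ A (hA : MeasurableSet[𝒜] A), φ₁ (ind P (h𝒜 A hA)) = φ₂ (ind P (h𝒜 A hA)))
    {X : Lp ℝ ∞ P} (hX : X ∈ Linf 𝒜 P) : φ₁ X = φ₂ X := by
  have hone : φ₁ (one P) = φ₂ (one P) := by
    have h := h_ind Set.univ (@MeasurableSet.univ _ 𝒜)
    have hu : ind P (h𝒜 _ (@MeasurableSet.univ _ 𝒜)) = one P := indicatorConstLp_univ ..
    rwa [hu] at h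
  have key : ∀ X ∈ LinfPos 𝒜 P, X ≤ one P → φ₁ X = φ₂ X := by
    intro X hX hX1
    have hC : ∀ X ∈ LinfPos 𝒜 P, X ≤ one P → |(φ₁ - φ₂) X| ≤ φ₁ (one P) + φ₂ (one P) := by
      intro X hX hX1
      have h3 := map_le_map h₁ hX.1 one_mem_LinfPos.1 hX1
      have h4 := map_le_map h₂ hX.1 one_mem_LinfPos.1 hX1
      have h5 := h₁ X hX
      have h6 := h₂ X hX
      rw [LinearMap.sub_apply]
      exact abs_le.2 ⟨by linarith, by linarith⟩
    have hlim : Tendsto (fun n : ℕ => (1 / 2 : ℝ) ^ n * (φ₁ (one P) + φ₂ (one P))) atTop (𝓝 0) := by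
      simpa using (tendsto_pow_atTop_nhds_zero_of_lt_one (r := (1 / 2 : ℝ)) (by norm_num)
        (by norm_num)).mul_const (φ₁ (one P) + φ₂ (one P))
    have h := ge_of_tendsto' hlim fun n => abs_map_le_pow (φ := φ₁ - φ₂) h𝒜
      (fun A hA => by rw [LinearMap.sub_apply, h_ind A hA, sub_self]) hC n X hX hX1
    have := abs_nonpos_iff.1 h
    rw [LinearMap.sub_apply] at this
    linarith
  -- an affine change of variables carries `X` into the order interval `[0, 1]`
  set c : ℝ := 2 * ‖X‖ + 1
  have hc : 0 < c := by positivity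
  have hX0 : 0 ≤ X + ‖X‖ • one P := by
    have := le_norm_smul_one (-X)
    rw [norm_neg] at this
    exact neg_le_iff_add_nonneg'.1 this
  have hmem : c⁻¹ • (X + ‖X‖ • one P) ∈ LinfPos 𝒜 P :=
    mem_LinfPos_smul (by positivity)
      ⟨add_mem hX (Submodule.smul_mem _ _ one_mem_LinfPos.1), hX0⟩
  have hle : c⁻¹ • (X + ‖X‖ • one P) ≤ one P := by
    have h := smul_le_smul_Linf (inv_nonneg.2 hc.le) (c := c⁻¹)
      (show X + ‖X‖ • one P ≤ c • one P from by
        have h1 := le_norm_smul_one X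
        have h2 := one_nonneg (P := P)
        calc X + ‖X‖ • one P ≤ ‖X‖ • one P + ‖X‖ • one P + one P :=
              (add_le_add_left h1 _).trans (le_add_of_nonneg_right h2)
          _ = c • one P := by simp only [c]; module)
    rwa [smul_smul, inv_mul_cancel₀ hc.ne', one_smul] at h
  have h := key _ hmem hle
  simp only [map_smul, map_add, smul_eq_mul, hone] at h
  have := mul_left_cancel₀ (inv_ne_zero hc.ne') h
  linarith

end Functionals

end

section

variable {Ω : Type*} {𝒜 ℬ : MeasurableSpace Ω} {mΩ : MeasurableSpace Ω} {P : Measure Ω}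
  {L : Submodule ℝ (Lp ℝ ∞ P)} {M m x : Lp ℝ ∞ P → Lp ℝ ∞ P}

/-! ### Extending a functional along one time step -/

theorem ae_of_finite_range {β : Type*} {g : Ω → β} (hg : (Set.range g).Finite)
    {p : β → Ω → Prop} (hp : ∀ v, ∀ᵐ ω ∂P, p v ω) : ∀ᵐ ω ∂P, p (g ω) ω := by
  filter_upwards [(ae_ball_iff hg.countable).2 fun v _ => hp v] with ω hω
  exact hω _ ⟨ω, rfl⟩

variable [IsProbabilityMeasure P]

theorem IsPriceOperator.map_zero (hx : IsPriceOperator 𝒜 L x) : x 0 = 0 := by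
  have h := hx.map_add 0 (zero_mem _) 0 (zero_mem _)
  rw [add_zero] at h
  exact left_eq_add.1 h

theorem IsPriceOperator.map_smul_of_nonneg (hx : IsPriceOperator 𝒜 L x) {X : Lp ℝ ∞ P}
    (hX : X ∈ L) {c : ℝ} (hc : 0 ≤ c) : x (c • X) = c • x X := by
  have h := hx.homogeneous X hX (c • one P) (mem_LinfPos_smul hc one_mem_LinfPos)
    (by rw [smul_one_mul]; exact L.smul_mem c hX)
  rwa [smul_one_mul, smul_one_mul] at h

theorem IsPriceOperator.map_neg (hx : IsPriceOperator 𝒜 L x) {X : Lp ℝ ∞ P} (hX : X ∈ L) :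
    x (-X) = -x X := by
  have h := hx.map_add X hX (-X) (neg_mem hX)
  rw [add_neg_cancel, hx.map_zero] at h
  exact (neg_eq_of_add_eq_zero_right h.symm).symm

/-- `X` is obtained by pasting together finitely many elements of `L` along a partition into sets
of `𝒜`, and `U` by pasting together their prices: `g ω` is the claim that is used at `ω`. -/
def IsLocalPair (𝒜 : MeasurableSpace Ω) {mΩ : MeasurableSpace Ω} {P : Measure Ω}
    (L : Submodule ℝ (Lp ℝ ∞ P)) (x : Lp ℝ ∞ P → Lp ℝ ∞ P) (X U : Lp ℝ ∞ P) : Prop :=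
  U ∈ Linf 𝒜 P ∧ ∃ g : @SimpleFunc Ω 𝒜 (Lp ℝ ∞ P), (∀ ω, g ω ∈ L) ∧
    (X =ᵐ[P] fun ω => g ω ω) ∧ U =ᵐ[P] fun ω => x (g ω) ω

theorem IsLocalPair.add (hx : IsPriceOperator 𝒜 L x) {X X' U U' : Lp ℝ ∞ P}
    (h : IsLocalPair 𝒜 L x X U) (h' : IsLocalPair 𝒜 L x X' U') :
    IsLocalPair 𝒜 L x (X + X') (U + U') := by
  obtain ⟨hU, g, hgL, hgX, hgU⟩ := h
  obtain ⟨hU', g', hgL', hgX', hgU'⟩ := h'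
  have hfin := @SimpleFunc.finite_range _ _ 𝒜 (@SimpleFunc.pair _ _ _ 𝒜 g g')
  refine ⟨add_mem hU hU', @SimpleFunc.map _ _ _ 𝒜 (fun v => v.1 + v.2)
    (@SimpleFunc.pair _ _ _ 𝒜 g g'), fun ω => add_mem (hgL ω) (hgL' ω), ?_, ?_⟩
  · filter_upwards [hgX, hgX', Lp.coeFn_add X X', ae_of_finite_range (P := P) hfin
      (p := fun v ω => (v.1 + v.2 : Lp ℝ ∞ P) ω = v.1 ω + v.2 ω)
      fun v => Lp.coeFn_add v.1 v.2] with ω h₁ h₂ h₃ h₄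
    rw [h₃, Pi.add_apply, h₁, h₂]
    exact h₄.symm
  · filter_upwards [hgU, hgU', Lp.coeFn_add U U', ae_of_finite_range (P := P) hfin
      (p := fun v ω => (x v.1 + x v.2 : Lp ℝ ∞ P) ω = x v.1 ω + x v.2 ω)
      fun v => Lp.coeFn_add (x v.1) (x v.2)] with ω h₁ h₂ h₃ h₄
    rw [h₃, Pi.add_apply, h₁, h₂]
    refine h₄.symm.trans ?_
    exact congrArg (fun V : Lp ℝ ∞ P => V ω) (hx.map_add _ (hgL ω) _ (hgL' ω)).symm

theorem IsLocalPair.smul (hx : IsPriceOperator 𝒜 L x) {X U : Lp ℝ ∞ P}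
    (h : IsLocalPair 𝒜 L x X U) {c : ℝ} (hc : 0 ≤ c) :
    IsLocalPair 𝒜 L x (c • X) (c • U) := by
  obtain ⟨hU, g, hgL, hgX, hgU⟩ := h
  have hfin := @SimpleFunc.finite_range _ _ 𝒜 g
  refine ⟨Submodule.smul_mem _ _ hU, @SimpleFunc.map _ _ _ 𝒜 (fun v => c • v) g,
    fun ω => L.smul_mem c (hgL ω), ?_, ?_⟩
  · filter_upwards [hgX, Lp.coeFn_smul c X, ae_of_finite_range (P := P) hfin
      (p := fun v ω => (c • v : Lp ℝ ∞ P) ω = c * v ω) fun v => Lp.coeFn_smul c v] with ω h₁ h₂ h₃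
    rw [h₂, Pi.smul_apply, h₁]
    exact h₃.symm
  · filter_upwards [hgU, Lp.coeFn_smul c U, ae_of_finite_range (P := P) hfin
      (p := fun v ω => (c • x v : Lp ℝ ∞ P) ω = c * x v ω)
      fun v => Lp.coeFn_smul c (x v)] with ω h₁ h₂ h₃
    rw [h₂, Pi.smul_apply, h₁]
    refine h₃.symm.trans ?_
    exact congrArg (fun V : Lp ℝ ∞ P => V ω) (hx.map_smul_of_nonneg (hgL ω) hc).symm

theorem isLocalPair_zero (hx : IsPriceOperator 𝒜 L x) : IsLocalPair 𝒜 L x 0 0 := by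
  refine ⟨zero_mem _, @SimpleFunc.const _ _ 𝒜 0, fun _ => zero_mem _, ?_, ?_⟩
  · rfl
  · simp only [@SimpleFunc.coe_const _ _ 𝒜, Function.const_apply, hx.map_zero]
    rfl

theorem isLocalPair_ind_mul (h𝒜 : 𝒜 ≤ mΩ) (hx : IsPriceOperator 𝒜 L x) {A : Set Ω}
    (hA : MeasurableSet[𝒜] A) {X : Lp ℝ ∞ P} (hX : X ∈ L) :
    IsLocalPair 𝒜 L x (mul (ind P (h𝒜 A hA)) X) (mul (ind P (h𝒜 A hA)) (x X)) := by
  classical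
  refine ⟨mul_mem_Linf (ind_mem_LinfPos h𝒜 hA).1 (hx.maps_to X hX),
    @SimpleFunc.piecewise _ _ 𝒜 A hA (@SimpleFunc.const _ _ 𝒜 X) (@SimpleFunc.const _ _ 𝒜 0),
    fun ω => ?_, ?_, ?_⟩
  · rw [@SimpleFunc.piecewise_apply _ _ 𝒜]
    split_ifs
    exacts [hX, zero_mem _]
  · filter_upwards [coeFn_ind_mul (h𝒜 A hA) X] with ω h₁
    rw [h₁, @SimpleFunc.piecewise_apply _ _ 𝒜]
    by_cases h : ω ∈ A <;> simp [h]
  · filter_upwards [coeFn_ind_mul (h𝒜 A hA) (x X)] with ω h₁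
    rw [h₁, @SimpleFunc.piecewise_apply _ _ 𝒜]
    by_cases h : ω ∈ A <;> simp [h, hx.map_zero]

/-- A price operator `x : L → L_∞(𝒜)`, `L ⊆ L_∞(ℬ)`, sandwiched between a superlinear operator `m`
and a sublinear operator `M` from `L_∞⁺(ℬ)` to `L_∞⁺(𝒜)`. -/
structure IsSandwich (𝒜 ℬ : MeasurableSpace Ω) {mΩ : MeasurableSpace Ω} {P : Measure Ω}
    [IsFiniteMeasure P] (L : Submodule ℝ (Lp ℝ ∞ P)) (M m x : Lp ℝ ∞ P → Lp ℝ ∞ P) : Prop where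
  le_left_right : 𝒜 ≤ ℬ
  le_right : ℬ ≤ mΩ
  maps_to_M : Set.MapsTo M (LinfPos ℬ P) (LinfPos 𝒜 P)
  sublinear : IsSublinear ℬ M
  homogeneous_M : IsHomogeneous 𝒜 (LinfPos ℬ P) M
  maps_to_m : Set.MapsTo m (LinfPos ℬ P) (LinfPos 𝒜 P)
  superlinear : IsSuperlinear ℬ m
  homogeneous_m : IsHomogeneous 𝒜 (LinfPos ℬ P) m
  price : IsPriceOperator 𝒜 L x
  one_mem : one P ∈ L
  sandwich : ∀ X ∈ L, ∀ Y ∈ LinfPos ℬ P, ∀ Z ∈ LinfPos ℬ P, Z + X ≤ Y → m Z + x X ≤ M Y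

/-- The sandwich condition is local: on a set `A ∈ 𝒜` where `X` coincides with a claim `v ∈ L`, it
follows from the inequality `1_A Z + v ≤ 1_A Y + ‖v‖ 1_{Aᶜ}`, because the values on `A` of
homogeneous operators depend only on the values of the argument on `A`. -/
theorem IsSandwich.sandwich_local (h : IsSandwich 𝒜 ℬ L M m x) {X U Y Z : Lp ℝ ∞ P}
    (hXU : IsLocalPair 𝒜 L x X U) (hY : Y ∈ LinfPos ℬ P) (hZ : Z ∈ LinfPos ℬ P)
    (hle : Z + X ≤ Y) : m Z + U ≤ M Y := by
  obtain ⟨hU, g, hgL, hgX, hgU⟩ := hXU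
  have h𝒜 := h.le_left_right.trans h.le_right
  have key : ∀ v : Lp ℝ ∞ P, ∀ᵐ ω ∂P, v ∈ L → g ω = v → m Z ω + x v ω ≤ M Y ω := by
    intro v
    by_cases hv : v ∈ L
    swap
    · simp [hv]
    set A : Set Ω := g ⁻¹' {v}
    have hA : MeasurableSet[𝒜] A := @SimpleFunc.measurableSet_fiber _ _ 𝒜 g v
    set I := ind P (h𝒜 A hA)
    set J := ind P (h𝒜 _ hA.compl)
    have hI : I ∈ LinfPos 𝒜 P := ind_mem_LinfPos h𝒜 hA
    have hIℬ := LinfPos_mono h.le_left_right hI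
    have hJ : J ∈ LinfPos ℬ P := LinfPos_mono h.le_left_right (ind_mem_LinfPos h𝒜 hA.compl)
    have hY' : mul I Y + ‖v‖ • J ∈ LinfPos ℬ P :=
      mem_LinfPos_add (mul_mem_LinfPos hIℬ hY) (mem_LinfPos_smul (norm_nonneg v) hJ)
    have hY'ae : ⇑(mul I Y + ‖v‖ • J) =ᵐ[P]
        fun ω => A.indicator Y ω + ‖v‖ * Aᶜ.indicator (fun _ => 1) ω := by
      filter_upwards [Lp.coeFn_add (mul I Y) (‖v‖ • J), coeFn_ind_mul (h𝒜 A hA) Y,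
        Lp.coeFn_smul ‖v‖ J, coeFn_ind (P := P) (h𝒜 _ hA.compl)] with ω h₁ h₂ h₃ h₄
      rw [h₁, Pi.add_apply, h₂, h₃, Pi.smul_apply, h₄, smul_eq_mul]
    have hZ' : mul I Z ∈ LinfPos ℬ P := mul_mem_LinfPos hIℬ hZ
    have hle' : mul I Z + v ≤ mul I Y + ‖v‖ • J := by
      rw [← Lp.coeFn_le] at hle ⊢
      filter_upwards [hle, hgX, hY'ae, Lp.coeFn_add (mul I Z) v, coeFn_ind_mul (h𝒜 A hA) Z,
        Lp.coeFn_add Z X, ae_abs_le_norm v] with ω h₁ h₂ h₃ h₄ h₅ h₆ h₇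
      rw [h₃, h₄, Pi.add_apply, h₅]
      by_cases hω : ω ∈ A
      · have hgv : g ω = v := hω
        rw [h₆, Pi.add_apply, h₂, hgv] at h₁
        simpa [hω] using h₁
      · simpa [hω] using (le_abs_self _).trans h₇
    have hmain := h.sandwich v hv _ hY' _ hZ' hle'
    have hIY' : mul I (mul I Y + ‖v‖ • J) = mul I Y := by
      refine Lp.ext ?_
      filter_upwards [coeFn_ind_mul (h𝒜 A hA) (mul I Y + ‖v‖ • J), hY'ae,
        coeFn_ind_mul (h𝒜 A hA) Y] with ω h₁ h₂ h₃
      rw [h₁, h₃]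
      by_cases hω : ω ∈ A
      · rw [Set.indicator_of_mem hω, Set.indicator_of_mem hω, h₂]
        simp [hω]
      · simp [hω]
    have hM₁ := h.homogeneous_M _ hY' I hI (by rw [hIY']; exact mul_mem_LinfPos hIℬ hY)
    have hM₂ := h.homogeneous_M _ hY I hI (mul_mem_LinfPos hIℬ hY)
    rw [hIY', hM₂] at hM₁
    rw [h.homogeneous_m _ hZ I hI hZ', ← Lp.coeFn_le] at hmain
    have hM₃ : ⇑(mul I (M Y)) =ᵐ[P] mul I (M (mul I Y + ‖v‖ • J)) := by rw [hM₁]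
    filter_upwards [hmain, hM₃, coeFn_ind_mul (h𝒜 A hA) (M Y),
      coeFn_ind_mul (h𝒜 A hA) (M (mul I Y + ‖v‖ • J)), coeFn_ind_mul (h𝒜 A hA) (m Z),
      Lp.coeFn_add (mul I (m Z)) (x v)] with ω h₁ h₂ h₃ h₄ h₅ h₆ _ hω
    have hω : ω ∈ A := hω
    rw [h₃, h₄, Set.indicator_of_mem hω, Set.indicator_of_mem hω] at h₂
    rw [h₆, Pi.add_apply, h₅, Set.indicator_of_mem hω, ← h₂] at h₁
    exact h₁
  rw [← Lp.coeFn_le]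
  filter_upwards [ae_of_finite_range (@SimpleFunc.finite_range _ _ 𝒜 g) key, hgU,
    Lp.coeFn_add (m Z) U] with ω h₁ h₂ h₃
  rw [h₃, Pi.add_apply, h₂]
  exact h₁ (hgL ω) rfl

/-- The pairs `(W, a)` such that `φ (M Y) - φ (m Z) - φ U ≤ a` for some `Y`, `Z` and some pasted
claim `X` with price `U` that satisfy `W + Z + X ≤ Y`. -/
def superhedgingCone (h : IsSandwich 𝒜 ℬ L M m x) (φ : Lp ℝ ∞ P →ₗ[ℝ] ℝ)
    (hφ : ∀ X ∈ LinfPos 𝒜 P, 0 ≤ φ X) : PointedCone ℝ (Lp ℝ ∞ P × ℝ) where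
  carrier := {w | ∃ Y ∈ LinfPos ℬ P, ∃ Z ∈ LinfPos ℬ P, ∃ X U, IsLocalPair 𝒜 L x X U ∧
    w.1 + Z + X ≤ Y ∧ φ (M Y) ≤ w.2 + φ (m Z) + φ U}
  zero_mem' := by
    refine ⟨0, mem_LinfPos_zero, 0, mem_LinfPos_zero, 0, 0, isLocalPair_zero h.price, by simp, ?_⟩
    have hM := h.sublinear.map_smul 0 mem_LinfPos_zero 0 le_rfl
    have hm := h.superlinear.map_smul 0 mem_LinfPos_zero 0 le_rfl
    rw [zero_smul, zero_smul] at hM hm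
    simp [hM, hm]
  add_mem' := by
    rintro w w' ⟨Y, hY, Z, hZ, X, U, hXU, h₁, h₂⟩ ⟨Y', hY', Z', hZ', X', U', hXU', h₁', h₂'⟩
    refine ⟨Y + Y', mem_LinfPos_add hY hY', Z + Z', mem_LinfPos_add hZ hZ', X + X', U + U',
      hXU.add h.price hXU', ?_, ?_⟩
    · calc w.1 + w'.1 + (Z + Z') + (X + X') = (w.1 + Z + X) + (w'.1 + Z' + X') := by abel
        _ ≤ Y + Y' := add_le_add h₁ h₁'
    · have hM := map_le_map hφ (h.maps_to_M (mem_LinfPos_add hY hY')).1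
        (add_mem (h.maps_to_M hY).1 (h.maps_to_M hY').1) (h.sublinear.map_add_le Y hY Y' hY')
      have hm := map_le_map hφ (add_mem (h.maps_to_m hZ).1 (h.maps_to_m hZ').1)
        (h.maps_to_m (mem_LinfPos_add hZ hZ')).1 (h.superlinear.le_map_add Z hZ Z' hZ')
      simp only [map_add, Prod.snd_add] at hM hm ⊢
      linarith
  smul_mem' := by
    rintro ⟨c, hc⟩ w ⟨Y, hY, Z, hZ, X, U, hXU, h₁, h₂⟩
    refine ⟨c • Y, mem_LinfPos_smul hc hY, c • Z, mem_LinfPos_smul hc hZ, c • X, c • U,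
      hXU.smul h.price hc, ?_, ?_⟩
    · have := smul_le_smul_Linf hc h₁
      rw [smul_add, smul_add] at this
      exact this
    · rw [h.sublinear.map_smul Y hY c hc, h.superlinear.map_smul Z hZ c hc]
      simp only [map_smul, smul_eq_mul]
      have := mul_le_mul_of_nonneg_left h₂ hc
      rw [mul_add, mul_add] at this
      exact this

/-- A positive functional on `L_∞(𝒜)` extends to a functional that respects the bounds `m`, `M`
and the prices `x`. The functional is read off from the M. Riesz extension of `(0, a) ↦ a` to a
functional that is non-negative on the superhedging cone. -/
theorem IsSandwich.exists_extension (h : IsSandwich 𝒜 ℬ L M m x) (φ : Lp ℝ ∞ P →ₗ[ℝ] ℝ)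
    (hφ : ∀ X ∈ LinfPos 𝒜 P, 0 ≤ φ X) :
    ∃ ψ : Lp ℝ ∞ P →ₗ[ℝ] ℝ, (∀ X ∈ Linf 𝒜 P, ψ X = φ X) ∧
      (∀ X ∈ LinfPos ℬ P, φ (m X) ≤ ψ X ∧ ψ X ≤ φ (M X)) ∧
      ∀ A (hA : MeasurableSet[𝒜] A), ∀ X ∈ L,
        ψ (mul (ind P (h.le_right _ (h.le_left_right A hA))) X) =
          φ (mul (ind P (h.le_right _ (h.le_left_right A hA))) (x X)) := by
  have h𝒜 := h.le_left_right.trans h.le_right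
  have hM0 : M 0 = 0 := by
    simpa using h.sublinear.map_smul 0 mem_LinfPos_zero 0 le_rfl
  have hm0 : m 0 = 0 := by
    simpa using h.superlinear.map_smul 0 mem_LinfPos_zero 0 le_rfl
  have h0 := isLocalPair_zero h.price
  let f : Lp ℝ ∞ P × ℝ →ₗ.[ℝ] ℝ :=
    ⟨LinearMap.range (LinearMap.inr ℝ (Lp ℝ ∞ P) ℝ),
      (LinearMap.snd ℝ (Lp ℝ ∞ P) ℝ).comp (Submodule.subtype _)⟩
  obtain ⟨G, hGf, hG⟩ := riesz_extension (superhedgingCone h φ hφ) f (by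
      rintro ⟨_, ⟨a, rfl⟩⟩ ⟨Y, hY, Z, hZ, X, U, hXU, h₁, h₂⟩
      change 0 ≤ a
      simp only [LinearMap.coe_inr, zero_add] at h₁ h₂
      have := map_le_map hφ (add_mem (h.maps_to_m hZ).1 hXU.1) (h.maps_to_M hY).1
        (h.sandwich_local hXU hY hZ h₁)
      rw [map_add] at this
      linarith) (by
      rintro ⟨W, b⟩
      refine ⟨⟨(0, φ (M (‖W‖ • one P)) - b), ⟨_, rfl⟩⟩, ‖W‖ • one P,
        mem_LinfPos_smul (norm_nonneg W) one_mem_LinfPos, 0, mem_LinfPos_zero, 0, 0, h0, ?_, ?_⟩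
      · simpa using le_norm_smul_one W
      · simp [hm0])
  have hG1 : G (0, 1) = 1 := hGf ⟨(0, 1), ⟨1, rfl⟩⟩
  let ψ : Lp ℝ ∞ P →ₗ[ℝ] ℝ := -(G.comp (LinearMap.inl ℝ (Lp ℝ ∞ P) ℝ))
  have key : ∀ Y ∈ LinfPos ℬ P, ∀ Z ∈ LinfPos ℬ P, ∀ X U, IsLocalPair 𝒜 L x X U →
      ∀ W, W + Z + X ≤ Y → ψ W ≤ φ (M Y) - φ (m Z) - φ U := by
    intro Y hY Z hZ X U hXU W hW
    have h1 := hG (W, φ (M Y) - φ (m Z) - φ U) ⟨Y, hY, Z, hZ, X, U, hXU, hW,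
      le_of_eq (by ring)⟩
    have h2 : ((W, φ (M Y) - φ (m Z) - φ U) : Lp ℝ ∞ P × ℝ) =
        (W, 0) + (φ (M Y) - φ (m Z) - φ U) • (0, 1) := by simp
    rw [h2, map_add, map_smul, hG1, smul_eq_mul, mul_one] at h1
    change -G (W, 0) ≤ _
    linarith
  have hbd : ∀ X ∈ LinfPos ℬ P, φ (m X) ≤ ψ X ∧ ψ X ≤ φ (M X) := by
    intro X hX
    constructor
    · have := key 0 mem_LinfPos_zero X hX 0 0 h0 (-X) (by simp)
      rw [map_neg, hM0, _root_.map_zero] at this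
      linarith
    · have := key X hX 0 mem_LinfPos_zero 0 0 h0 X (by simp)
      rw [hm0, _root_.map_zero] at this
      linarith
  have hloc : ∀ X U, IsLocalPair 𝒜 L x X U → φ U ≤ ψ X := by
    intro X U hXU
    have := key 0 mem_LinfPos_zero 0 mem_LinfPos_zero X U hXU (-X) (by simp)
    rw [map_neg, hM0, hm0, _root_.map_zero] at this
    linarith
  have hprice : ∀ A (hA : MeasurableSet[𝒜] A), ∀ X ∈ L,
      ψ (mul (ind P (h𝒜 A hA)) X) = φ (mul (ind P (h𝒜 A hA)) (x X)) := by
    intro A hA X hX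
    refine le_antisymm ?_ (hloc _ _ (isLocalPair_ind_mul h𝒜 h.price hA hX))
    have h1 := hloc _ _ (isLocalPair_ind_mul h𝒜 h.price hA (neg_mem hX))
    rw [h.price.map_neg hX, mul_neg_right, mul_neg_right, map_neg, map_neg] at h1
    linarith
  refine ⟨ψ, fun X hX => ?_, hbd, hprice⟩
  refine map_eq_of_map_ind_eq h𝒜 (fun X hX => ?_) hφ (fun A hA => ?_) hX
  · have hXℬ := LinfPos_mono h.le_left_right hX
    exact (hφ _ (h.maps_to_m hXℬ)).trans (hbd X hXℬ).1
  · have := hprice A hA (one P) h.one_mem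
    rwa [h.price.map_one, mul_one_right] at this

end

section

variable {Ω : Type*} {𝒜 ℬ : MeasurableSpace Ω} {mΩ : MeasurableSpace Ω} {P : Measure Ω}
  [IsProbabilityMeasure P]

/-! ### A functional for all times -/

/-- `φ` respects the bounds `m`, `M` and the prices `x` between the `σ`-algebras `𝒜` and `ℬ`. For
`φ = E_Q` and `𝒜`-homogeneous `m` and `M` this means that `m X ≤ E_Q[X | 𝒜] ≤ M X` for
`X ∈ L_∞⁺(ℬ)` and `x X = E_Q[X | 𝒜]` for `X ∈ L`. All conditions are linear in `φ`. -/
structure IsCompatible (𝒜 ℬ : MeasurableSpace Ω) {mΩ : MeasurableSpace Ω} {P : Measure Ω}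
    [IsProbabilityMeasure P] (L : Submodule ℝ (Lp ℝ ∞ P)) (M m x : Lp ℝ ∞ P → Lp ℝ ∞ P)
    (φ : Lp ℝ ∞ P →ₗ[ℝ] ℝ) : Prop where
  lower : ∀ X ∈ LinfPos ℬ P, φ (m X) ≤ φ X
  upper : ∀ X ∈ LinfPos ℬ P, φ X ≤ φ (M X)
  price : ∀ A, MeasurableSet[𝒜] A → ∀ hA : MeasurableSet A, ∀ X ∈ L,
    φ (mul (ind P hA) X) = φ (mul (ind P hA) (x X))

theorem IsCompatible.congr {L : Submodule ℝ (Lp ℝ ∞ P)} {M m x : Lp ℝ ∞ P → Lp ℝ ∞ P}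
    {φ ψ : Lp ℝ ∞ P →ₗ[ℝ] ℝ} (h : IsSandwich 𝒜 ℬ L M m x) (hL : L ≤ Linf ℬ P)
    (hφ : IsCompatible 𝒜 ℬ L M m x φ) (hψ : ∀ X ∈ Linf ℬ P, ψ X = φ X) :
    IsCompatible 𝒜 ℬ L M m x ψ where
  lower X hX := by
    rw [hψ _ hX.1, hψ _ (Linf_mono h.le_left_right (h.maps_to_m hX).1)]
    exact hφ.lower X hX
  upper X hX := by
    rw [hψ _ hX.1, hψ _ (Linf_mono h.le_left_right (h.maps_to_M hX).1)]
    exact hφ.upper X hX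
  price A hA hA' X hX := by
    have hI := (ind_mem_LinfPos (P := P) h.le_right (h.le_left_right _ hA)).1
    rw [hψ _ (mul_mem_Linf hI (hL hX)),
      hψ _ (mul_mem_Linf hI (Linf_mono h.le_left_right (h.price.maps_to X hX)))]
    exact hφ.price A hA hA' X hX

/-- When both `σ`-algebras coincide, every positive functional is compatible, since its extension
along that step is the functional itself. -/
theorem IsSandwich.isCompatible_self {L : Submodule ℝ (Lp ℝ ∞ P)} {M m x : Lp ℝ ∞ P → Lp ℝ ∞ P}
    {φ : Lp ℝ ∞ P →ₗ[ℝ] ℝ} (h : IsSandwich 𝒜 𝒜 L M m x) (hL : L ≤ Linf 𝒜 P)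
    (hφ : ∀ X ∈ LinfPos 𝒜 P, 0 ≤ φ X) : IsCompatible 𝒜 𝒜 L M m x φ := by
  obtain ⟨ψ, hψ, hbd, hprice⟩ := h.exists_extension φ hφ
  refine ⟨fun X hX => ?_, fun X hX => ?_, fun A hA hA' X hX => ?_⟩
  · rw [← hψ X hX.1]
    exact (hbd X hX).1
  · rw [← hψ X hX.1]
    exact (hbd X hX).2
  · rw [← hψ _ (mul_mem_Linf (ind_mem_LinfPos h.le_right hA).1 (hL hX))]
    exact hprice A hA X hX

variable {ι : Type*} [LinearOrder ι] {𝓕 : Filtration ι mΩ} {L : ι → Submodule ℝ (Lp ℝ ∞ P)}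
  {M m x : ι → ι → Lp ℝ ∞ P → Lp ℝ ∞ P}

/-- For finitely many times a compatible functional is built by extending `φ₀` from one time to the
next. Weak time-consistency yields the bounds over several steps: if `ψ` has the bounds for the
pairs `(s, b)` and `(b, a)`, then `ψ X ≤ ψ (M b a X) ≤ ψ (M s b (M b a X)) ≤ ψ (M s a X)`. -/
theorem exists_isCompatible_finset {o : ι} (ho : ∀ i, o ≤ i)
    (hS : ∀ s t, s ≤ t → IsSandwich (𝓕 s) (𝓕 t) (L t) (M s t) (m s t) (x s t))
    (hL : ∀ t, L t ≤ Linf (𝓕 t) P)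
    (hM : ∀ r s t, r ≤ s → s ≤ t → ∀ X ∈ LinfPos (𝓕 t) P, M r s (M s t X) ≤ M r t X)
    (hm : ∀ r s t, r ≤ s → s ≤ t → ∀ X ∈ LinfPos (𝓕 t) P, m r t X ≤ m r s (m s t X))
    (hxL : ∀ s t, s ≤ t → ∀ X ∈ L t, x s t X ∈ L s)
    (hx : ∀ r s t, r ≤ s → s ≤ t → ∀ X ∈ L t, x r t X = x r s (x s t X))
    (φ₀ : Lp ℝ ∞ P →ₗ[ℝ] ℝ) (hφ₀ : ∀ X ∈ LinfPos (𝓕 o) P, 0 ≤ φ₀ X) (F : Finset ι) :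
    ∃ φ : Lp ℝ ∞ P →ₗ[ℝ] ℝ, (∀ X ∈ Linf (𝓕 o) P, φ X = φ₀ X) ∧
      (∀ t ∈ insert o F, ∀ X ∈ LinfPos (𝓕 t) P, 0 ≤ φ X) ∧
      ∀ s ∈ insert o F, ∀ t ∈ insert o F, s ≤ t →
        IsCompatible (𝓕 s) (𝓕 t) (L t) (M s t) (m s t) (x s t) φ := by
  induction F using Finset.induction_on_max with
  | empty =>
    refine ⟨φ₀, fun X _ => rfl, by simpa using hφ₀, ?_⟩
    simpa using (hS o o le_rfl).isCompatible_self (hL o) hφ₀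
  | insert a F ha ih =>
    obtain ⟨φ, hφo, hφ, hφc⟩ := ih
    rcases eq_or_lt_of_le (ho a) with rfl | hoa
    · exact ⟨φ, hφo, by simpa using hφ, by simpa using hφc⟩
    -- extend `φ` from the largest time `b` in `insert o F` to `a`
    obtain ⟨b, hbF, hb⟩ : ∃ b ∈ insert o F, ∀ t ∈ insert o F, t ≤ b :=
      ⟨(insert o F).max' (Finset.insert_nonempty o F), Finset.max'_mem _ _,
        fun t ht => Finset.le_max' _ t ht⟩
    have hba : b < a := by
      rcases Finset.mem_insert.1 hbF with rfl | h
      exacts [hoa, ha b h]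
    have hSba := hS b a hba.le
    obtain ⟨ψ, hψ, hbd, hprice⟩ := hSba.exists_extension φ (hφ b hbF)
    have hψ' : ∀ t ≤ b, ∀ X ∈ Linf (𝓕 t) P, ψ X = φ X := fun t ht X hX =>
      hψ X (Linf_mono (𝓕.mono ht) hX)
    have hψa : ∀ X ∈ LinfPos (𝓕 a) P, 0 ≤ ψ X := fun X hX =>
      (hφ b hbF _ (hSba.maps_to_m hX)).trans (hbd X hX).1
    have hψc : ∀ s ∈ insert o F, IsCompatible (𝓕 s) (𝓕 a) (L a) (M s a) (m s a) (x s a) ψ := by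
      intro s hs
      have hsb := hb s hs
      have hSsb := hS s b hsb
      have hSsa := hS s a (hsb.trans hba.le)
      have hc := hφc s hs b hbF hsb
      refine ⟨fun X hX => ?_, fun X hX => ?_, fun A hA hA' X hX => ?_⟩
      · have hmX := hSba.maps_to_m hX
        rw [hψ' s hsb _ (hSsa.maps_to_m hX).1]
        calc φ (m s a X) ≤ φ (m s b (m b a X)) := map_le_map (hφ s hs) (hSsa.maps_to_m hX).1
              (hSsb.maps_to_m hmX).1 (hm s b a hsb hba.le X hX)
          _ ≤ φ (m b a X) := hc.lower _ hmX
          _ ≤ ψ X := (hbd X hX).1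
      · have hMX := hSba.maps_to_M hX
        rw [hψ' s hsb _ (hSsa.maps_to_M hX).1]
        calc ψ X ≤ φ (M b a X) := (hbd X hX).2
          _ ≤ φ (M s b (M b a X)) := hc.upper _ hMX
          _ ≤ φ (M s a X) := map_le_map (hφ s hs) (hSsb.maps_to_M hMX).1
              (hSsa.maps_to_M hX).1 (hM s b a hsb hba.le X hX)
      · have hI := (ind_mem_LinfPos (P := P) (𝓕.le s) hA).1
        rw [hψ' s hsb _ (mul_mem_Linf hI (hSsa.price.maps_to X hX)), hx s b a hsb hba.le X hX,
          ← hc.price A hA hA' _ (hxL b a hba.le X hX)]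
        exact hprice A (𝓕.mono hsb A hA) X hX
    have hlt : ∀ t ∈ insert o F, t < a := fun t ht => (hb t ht).trans_lt hba
    have hcases : ∀ t ∈ insert o (insert a F), t = a ∨ t ∈ insert o F := by
      intro t ht
      simp only [Finset.mem_insert] at ht ⊢
      tauto
    refine ⟨ψ, fun X hX => (hψ' o (ho b) X hX).trans (hφo X hX), fun t ht X hX => ?_,
      fun s hs t ht hst => ?_⟩
    · rcases hcases t ht with rfl | h
      · exact hψa X hX
      · exact hψa X (LinfPos_mono (𝓕.mono (hlt t h).le) hX)
    · rcases hcases t ht with rfl | ht'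
      · rcases hcases s hs with rfl | hs'
        · exact (hS s s hst).isCompatible_self (hL s) hψa
        · exact hψc s hs'
      · rcases hcases s hs with rfl | hs'
        · exact absurd (hlt t ht') hst.not_gt
        · exact (hφc s hs' t ht' hst).congr (hS s t hst) (hL t) (hψ' t (hb t ht'))

/-- A compatible functional for all times is a pointwise limit, along an ultrafilter of finite sets
of times, of functionals that are compatible for these times. -/
theorem exists_isCompatible {o e : ι} (ho : ∀ i, o ≤ i) (he : 𝓕 e = mΩ)
    (hS : ∀ s t, s ≤ t → IsSandwich (𝓕 s) (𝓕 t) (L t) (M s t) (m s t) (x s t))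
    (hL : ∀ t, L t ≤ Linf (𝓕 t) P)
    (hM : ∀ r s t, r ≤ s → s ≤ t → ∀ X ∈ LinfPos (𝓕 t) P, M r s (M s t X) ≤ M r t X)
    (hm : ∀ r s t, r ≤ s → s ≤ t → ∀ X ∈ LinfPos (𝓕 t) P, m r t X ≤ m r s (m s t X))
    (hxL : ∀ s t, s ≤ t → ∀ X ∈ L t, x s t X ∈ L s)
    (hx : ∀ r s t, r ≤ s → s ≤ t → ∀ X ∈ L t, x r t X = x r s (x s t X))
    (φ₀ : Lp ℝ ∞ P →ₗ[ℝ] ℝ) (hφ₀ : ∀ X ∈ LinfPos (𝓕 o) P, 0 ≤ φ₀ X) :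
    ∃ φ : Lp ℝ ∞ P →ₗ[ℝ] ℝ, (∀ X ∈ Linf (𝓕 o) P, φ X = φ₀ X) ∧ (∀ X, 0 ≤ X → 0 ≤ φ X) ∧
      ∀ s t, s ≤ t → IsCompatible (𝓕 s) (𝓕 t) (L t) (M s t) (m s t) (x s t) φ := by
  choose φ hφo hφ hφc using exists_isCompatible_finset ho hS hL hM hm hxL hx φ₀ hφ₀
  let U : Ultrafilter (Finset ι) := Ultrafilter.of atTop
  have hU : ∀ t, ∀ᶠ F in (U : Filter (Finset ι)), t ∈ insert o F := fun t =>
    Ultrafilter.of_le atTop ((eventually_ge_atTop {t}).mono fun F hF =>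
      Finset.mem_insert_of_mem (hF (Finset.mem_singleton_self t)))
  have hpos : ∀ᶠ F in (U : Filter (Finset ι)), ∀ X, 0 ≤ X → 0 ≤ φ F X := by
    filter_upwards [hU e] with F hF X hX
    exact hφ F e hF X (by rw [he]; exact mem_LinfPos_top hX)
  have hlim : ∀ X, ∃ c, Tendsto (fun F => φ F X) U (𝓝 c) := by
    intro X
    obtain ⟨c, -, hc⟩ := (isCompact_Icc (a := -(‖X‖ * φ₀ (one P)))
      (b := ‖X‖ * φ₀ (one P))).ultrafilter_le_nhds (U.map fun F => φ F X) (by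
        rw [le_principal_iff]
        refine Filter.mem_map.2 ?_
        filter_upwards [hU e] with F hF
        have h := abs_map_le (φ := φ F) (𝒜 := 𝓕 e) (hφ F e hF)
          (X := X) (by rw [he]; exact mem_Linf.2 (Lp.aestronglyMeasurable X))
        rw [hφo F _ one_mem_LinfPos.1] at h
        exact abs_le.1 h)
    exact ⟨c, hc⟩
  choose ψ hψ using hlim
  let Ψ : Lp ℝ ∞ P →ₗ[ℝ] ℝ :=
    { toFun := ψ
      map_add' := fun X Y => tendsto_nhds_unique (hψ (X + Y)) (by
        simpa using (hψ X).add (hψ Y))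
      map_smul' := fun c X => tendsto_nhds_unique (hψ (c • X)) (by
        simpa using (hψ X).const_mul c) }
  refine ⟨Ψ, fun X hX => ?_, fun X hX => ?_, fun s t hst => ⟨fun X hX => ?_, fun X hX => ?_,
    fun A hA hA' X hX => ?_⟩⟩
  · exact tendsto_nhds_unique (hψ X) (tendsto_const_nhds.congr fun F => (hφo F X hX).symm)
  · exact ge_of_tendsto (hψ X) (hpos.mono fun F hF => hF X hX)
  · refine le_of_tendsto_of_tendsto (hψ _) (hψ _) ?_
    filter_upwards [hU s, hU t] with F hs ht
    exact (hφc F s hs t ht hst).lower X hX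
  · refine le_of_tendsto_of_tendsto (hψ _) (hψ _) ?_
    filter_upwards [hU s, hU t] with F hs ht
    exact (hφc F s hs t ht hst).upper X hX
  · refine tendsto_nhds_unique_of_eventuallyEq (hψ _) (hψ _) ?_
    filter_upwards [hU s, hU t] with F hs ht
    exact (hφc F s hs t ht hst).price A hA hA' X hX

end

section

variable {Ω : Type*} {𝒜 ℬ : MeasurableSpace Ω} {mΩ : MeasurableSpace Ω} {P : Measure Ω}

/-! ### From functionals to measures -/

/-- The functional `X ↦ E_μ[X]` on `L_∞(P)`, for a finite measure `μ ≪ P`. -/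
def integralFunctional {μ : Measure Ω} [IsFiniteMeasure μ] (hμ : μ ≪ P) : Lp ℝ ∞ P →ₗ[ℝ] ℝ where
  toFun X := ∫ ω, X ω ∂μ
  map_add' X Y := by
    rw [← integral_add (integrable_coeFn X hμ) (integrable_coeFn Y hμ)]
    exact integral_congr_ae (hμ.ae_le (Lp.coeFn_add X Y))
  map_smul' c X := by
    rw [RingHom.id_apply, smul_eq_mul, ← integral_const_mul]
    exact integral_congr_ae (hμ.ae_le (Lp.coeFn_smul c X))

theorem integralFunctional_nonneg {μ : Measure Ω} [IsFiniteMeasure μ] (hμ : μ ≪ P)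
    {X : Lp ℝ ∞ P} (hX : 0 ≤ X) : 0 ≤ integralFunctional hμ X :=
  integral_nonneg_of_ae (hμ.ae_le ((Lp.coeFn_nonneg X).2 hX))

variable [IsProbabilityMeasure P]

theorem integralFunctional_ind_mul {μ : Measure Ω} [IsFiniteMeasure μ] (hμ : μ ≪ P) {A : Set Ω}
    (hA : MeasurableSet A) (X : Lp ℝ ∞ P) :
    integralFunctional hμ (mul (ind P hA) X) = ∫ ω in A, X ω ∂μ := by
  rw [← integral_indicator hA]
  exact integral_congr_ae (hμ.ae_le (coeFn_ind_mul hA X))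

theorem integralFunctional_ind {μ : Measure Ω} [IsFiniteMeasure μ] (hμ : μ ≪ P) {A : Set Ω}
    (hA : MeasurableSet A) : integralFunctional hμ (ind P hA) = μ.real A := by
  refine (integral_congr_ae (hμ.ae_le (coeFn_ind (P := P) hA))).trans ?_
  rw [integral_indicator_const _ hA, smul_eq_mul, mul_one]

/-- A functional that is dominated by `E_P ∘ M`, where `M` is regular, is continuous from above at
zero. As `M` need not be monotone, `E_P[M (X n)]` itself need not tend to zero; but `M (X n)` is
small off a set of `𝒜` of small probability, and on `𝒜` the functional is `E_P`. -/
theorem IsRegular.tendsto_map_zero (h𝒜 : 𝒜 ≤ mΩ) {M : Lp ℝ ∞ P → Lp ℝ ∞ P}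
    (hM : Set.MapsTo M (LinfPos mΩ P) (LinfPos 𝒜 P)) (hM_hom : IsHomogeneous 𝒜 (LinfPos mΩ P) M)
    (hM_reg : IsRegular mΩ M) {φ : Lp ℝ ∞ P →ₗ[ℝ] ℝ} (hφ : ∀ X, 0 ≤ X → 0 ≤ φ X)
    (hφ𝒜 : ∀ X ∈ Linf 𝒜 P, φ X = ∫ ω, X ω ∂P) (hφM : ∀ X, 0 ≤ X → φ X ≤ φ (M X))
    {X : ℕ → Lp ℝ ∞ P} (hX : ∀ n, 0 ≤ X n) (hX1 : ∀ n, X n ≤ one P) (hanti : Antitone X)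
    (hlim : ∀ᵐ ω ∂P, Tendsto (fun n => X n ω) atTop (𝓝 0)) :
    Tendsto (fun n => φ (X n)) atTop (𝓝 0) := by
  have hmem : ∀ n, X n ∈ LinfPos mΩ P := fun n => mem_LinfPos_top (hX n)
  have hMmem : ∀ n, M (X n) ∈ LinfPos 𝒜 P := fun n => hM (hmem n)
  have hmono : ∀ {X Y : Lp ℝ ∞ P}, X ≤ Y → φ X ≤ φ Y := fun {X Y} h =>
    map_le_map (𝒜 := mΩ) (fun X hX => hφ X hX.2) (mem_Linf.2 (Lp.aestronglyMeasurable X))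
      (mem_Linf.2 (Lp.aestronglyMeasurable Y)) h
  have hmeas := tendstoInMeasure_iff_measureReal_norm.1 (tendstoInMeasure_of_tendsto_ae
    (fun n => Lp.aestronglyMeasurable (M (X n))) (hM_reg X hmem hanti hlim))
  have hbound : ∀ ε > 0, ∀ n, φ (X n) ≤ ε + P.real {ω | ε ≤ ‖M (X n) ω - 0‖} := by
    intro ε hε n
    obtain ⟨g, hg, hMg⟩ := mem_Linf.1 (hMmem n).1
    have hA : MeasurableSet[𝒜] {ω | g ω < ε} := hg.measurable measurableSet_Iio
    set A := {ω | g ω < ε}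
    have hI := ind_mem_LinfPos (P := P) h𝒜 hA
    have hsplit : X n ≤ mul (ind P (h𝒜 A hA)) (X n) + ind P (h𝒜 A hA).compl := by
      have h1 := hX1 n
      rw [← Lp.coeFn_le] at h1 ⊢
      filter_upwards [h1, coeFn_one (P := P), coeFn_ind_mul (h𝒜 A hA) (X n),
        coeFn_ind (P := P) (h𝒜 A hA).compl, Lp.coeFn_add (mul (ind P (h𝒜 A hA)) (X n))
        (ind P (h𝒜 A hA).compl)] with ω h₁ h₂ h₃ h₄ h₅
      rw [h₅, Pi.add_apply, h₃, h₄]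
      rw [h₂] at h₁
      by_cases hω : ω ∈ A <;> simp [hω, h₁]
    have hIX : mul (ind P (h𝒜 A hA)) (X n) ∈ LinfPos mΩ P :=
      mul_mem_LinfPos (LinfPos_mono h𝒜 hI) (hmem n)
    have h1 : φ (mul (ind P (h𝒜 A hA)) (X n)) ≤ ε := by
      refine (hφM _ hIX.2).trans ?_
      rw [hM_hom _ (hmem n) _ hI hIX, hφ𝒜 _ (mul_mem_Linf hI.1 (hMmem n).1)]
      calc ∫ ω, mul (ind P (h𝒜 A hA)) (M (X n)) ω ∂P ≤ ∫ _, ε ∂P := by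
            refine integral_mono_ae (integrable_coeFn _ .rfl) (integrable_const _) ?_
            filter_upwards [coeFn_ind_mul (h𝒜 A hA) (M (X n)), hMg] with ω h₁ h₂
            rw [h₁]
            by_cases hω : ω ∈ A
            · rw [Set.indicator_of_mem hω, h₂]
              exact le_of_lt hω
            · rw [Set.indicator_of_notMem hω]
              exact hε.le
        _ = ε := by simp
    have h2 : φ (ind P (h𝒜 A hA).compl) ≤ P.real {ω | ε ≤ ‖M (X n) ω - 0‖} := by
      rw [hφ𝒜 _ (ind_mem_LinfPos h𝒜 hA.compl).1]
      refine (integralFunctional_ind (P := P) .rfl (h𝒜 A hA).compl).trans_le ?_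
      refine ENNReal.toReal_mono (measure_ne_top _ _) (measure_mono_ae ?_)
      filter_upwards [hMg] with ω h₁ h₂
      have h₃ : ε ≤ g ω := not_lt.1 h₂
      change ε ≤ ‖M (X n) ω - 0‖
      rw [sub_zero, h₁]
      exact h₃.trans (le_abs_self _)
    have h3 := hmono hsplit
    rw [map_add] at h3
    linarith
  refine Metric.tendsto_atTop.2 fun ε hε => ?_
  have hev := (hmeas (ε / 2) (half_pos hε)).eventually (gt_mem_nhds (half_pos hε))
  obtain ⟨N, hN⟩ := eventually_atTop.1 hev
  refine ⟨N, fun n hn => ?_⟩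
  rw [Real.dist_eq, sub_zero, abs_of_nonneg (hφ _ (hX n))]
  have h1 := hbound (ε / 2) (half_pos hε) n
  have h2 := hN n hn
  linarith

/-- A functional that is dominated by `E_P ∘ M`, where `M` is weak* continuous, is continuous from
above at zero. -/
theorem IsWeakStarContinuous.tendsto_map_zero {M : Lp ℝ ∞ P → Lp ℝ ∞ P}
    (hM : Set.MapsTo M (LinfPos mΩ P) (LinfPos 𝒜 P)) (hM0 : M 0 = 0)
    (hM_cont : IsWeakStarContinuous 𝒜 mΩ M) {φ : Lp ℝ ∞ P →ₗ[ℝ] ℝ} (hφ : ∀ X, 0 ≤ X → 0 ≤ φ X)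
    (hφ𝒜 : ∀ X ∈ Linf 𝒜 P, φ X = ∫ ω, X ω ∂P) (hφM : ∀ X, 0 ≤ X → φ X ≤ φ (M X))
    {X : ℕ → Lp ℝ ∞ P} (hX : ∀ n, 0 ≤ X n) (hX1 : ∀ n, X n ≤ one P)
    (hlim : ∀ᵐ ω ∂P, Tendsto (fun n => X n ω) atTop (𝓝 0)) :
    Tendsto (fun n => φ (X n)) atTop (𝓝 0) := by
  have hmem : ∀ n, X n ∈ LinfPos mΩ P := fun n => mem_LinfPos_top (hX n)
  have hconv : Tendsto X atTop (@nhds _ (weakStar mΩ P) 0) := by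
    rw [@nhds_iInf]
    refine tendsto_iInf.2 fun f => ?_
    rw [@nhds_induced, tendsto_comap_iff]
    have hf : Integrable (f : Lp ℝ 1 P) P := L1.integrable_coeFn _
    have h0 : ∫ ω, (f : Lp ℝ 1 P) ω * (0 : Lp ℝ ∞ P) ω ∂P = ∫ _, (0 : ℝ) ∂P := by
      refine integral_congr_ae ?_
      filter_upwards [Lp.coeFn_zero ℝ ∞ P] with ω h
      rw [h, Pi.zero_apply, mul_zero]
    rw [h0]
    refine tendsto_integral_of_dominated_convergence (fun ω => ‖(f : Lp ℝ 1 P) ω‖)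
      (fun n => hf.aestronglyMeasurable.mul (Lp.aestronglyMeasurable (X n))) hf.norm
      (fun n => ?_) ?_
    · have h1 := hX1 n
      have h0 := hX n
      rw [← Lp.coeFn_le] at h1
      rw [← Lp.coeFn_nonneg] at h0
      filter_upwards [h0, h1, coeFn_one (P := P)] with ω h₀ h₁ h₂
      rw [h₂] at h₁
      rw [norm_mul]
      refine mul_le_of_le_one_right (norm_nonneg _) ?_
      rw [Real.norm_eq_abs, abs_of_nonneg h₀]
      exact h₁
    · filter_upwards [hlim] with ω h
      simpa using h.const_mul ((f : Lp ℝ 1 P) ω)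
  have hcw : Tendsto M (@nhdsWithin _ (weakStar mΩ P) 0 (LinfPos mΩ P))
      (@nhds _ (weakStar 𝒜 P) (M 0)) := hM_cont 0 mem_LinfPos_zero
  have hMconv : Tendsto (fun n => M (X n)) atTop (@nhds _ (weakStar 𝒜 P) 0) := by
    rw [hM0] at hcw
    refine hcw.comp ?_
    exact tendsto_inf.2 ⟨hconv, tendsto_principal.2 (Eventually.of_forall hmem)⟩
  -- test the convergence with the constant density `1`
  let c : lpMeas ℝ ℝ 𝒜 1 P := ⟨Lp.const 1 P (1 : ℝ), mem_lpMeas_iff_aestronglyMeasurable.2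
    (aestronglyMeasurable_const.congr (Lp.coeFn_const 1 P (1 : ℝ)).symm)⟩
  have hc : ∀ Y : Lp ℝ ∞ P, ∫ ω, (c : Lp ℝ 1 P) ω * Y ω ∂P = ∫ ω, Y ω ∂P := fun Y => by
    refine integral_congr_ae ?_
    filter_upwards [Lp.coeFn_const 1 P (1 : ℝ)] with ω h
    rw [h, Function.const_apply, one_mul]
  rw [@nhds_iInf] at hMconv
  have h1 := tendsto_iInf.1 hMconv c
  rw [@nhds_induced, tendsto_comap_iff, hc] at h1
  have h2 : Tendsto (fun n => φ (M (X n))) atTop (𝓝 0) := by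
    have h0 : ∫ ω, (0 : Lp ℝ ∞ P) ω ∂P = 0 := (integralFunctional (P := P) .rfl).map_zero
    rw [h0] at h1
    refine h1.congr fun n => ?_
    rw [hφ𝒜 _ (hM (hmem n)).1]
    exact hc _
  exact squeeze_zero (fun n => hφ _ (hX n)) (fun n => hφM _ (hX n)) h2

/-- A positive normalized functional that is continuous from above along indicators is the
expectation with respect to a probability measure. -/
theorem exists_measure_eq_integral {φ : Lp ℝ ∞ P →ₗ[ℝ] ℝ} (hφ : ∀ X, 0 ≤ X → 0 ≤ φ X)
    (hφ1 : φ (one P) = 1)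
    (hcont : ∀ B : ℕ → Set Ω, ∀ hB : ∀ n, MeasurableSet (B n), Antitone B → ⋂ n, B n = ∅ →
      Tendsto (fun n => φ (ind P (hB n))) atTop (𝓝 0)) :
    ∃ P₀ : Measure Ω, ∃ _ : IsProbabilityMeasure P₀, ∃ hP₀ : P₀ ≪ P,
      ∀ X, φ X = integralFunctional hP₀ X := by
  have hind : ∀ {A : Set Ω} (hA : MeasurableSet A), 0 ≤ φ (ind P hA) := fun hA =>
    hφ _ (ind_nonneg hA)
  have hsum : ∀ f : ℕ → Set Ω, ∀ hf : ∀ i, MeasurableSet (f i),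
      Pairwise (Function.onFun Disjoint f) →
      HasSum (fun i => φ (ind P (hf i))) (φ (ind P (MeasurableSet.iUnion hf))) := by
    intro f hf hdisj
    rw [hasSum_iff_tendsto_nat_of_nonneg fun i => hind (hf i)]
    let R : ℕ → Set Ω := fun n => ⋃ i, ⋃ _ : n ≤ i, f i
    have hR : ∀ n, MeasurableSet (R n) := fun n =>
      MeasurableSet.iUnion fun i => MeasurableSet.iUnion fun _ => hf i
    have hRmem : ∀ n ω, ω ∈ R n ↔ ∃ i, n ≤ i ∧ ω ∈ f i := fun n ω => by simp [R]
    have hstep : ∀ n, φ (ind P (hR n)) = φ (ind P (hf n)) + φ (ind P (hR (n + 1))) := by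
      intro n
      have hd : Disjoint (f n) (R (n + 1)) := by
        refine Set.disjoint_left.2 fun ω h₁ h₂ => ?_
        obtain ⟨i, hi, h₃⟩ := (hRmem _ _).1 h₂
        exact Set.disjoint_left.1 (hdisj (show n ≠ i by omega)) h₁ h₃
      have hu : R n = f n ∪ R (n + 1) := by
        ext ω
        rw [Set.mem_union, hRmem, hRmem]
        constructor
        · rintro ⟨i, hi, h⟩
          rcases eq_or_lt_of_le hi with rfl | hi
          exacts [Or.inl h, Or.inr ⟨i, hi, h⟩]
        · rintro (h | ⟨i, hi, h⟩)
          exacts [⟨n, le_rfl, h⟩, ⟨i, by omega, h⟩]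
      rw [← map_add, ← ind_union (hf n) (hR (n + 1)) hd]
      congr 2
    have hpartial : ∀ n, ∑ i ∈ Finset.range n, φ (ind P (hf i)) =
        φ (ind P (hR 0)) - φ (ind P (hR n)) := by
      intro n
      induction n with
      | zero => simp
      | succ n ih => rw [Finset.sum_range_succ, ih, hstep n]; ring
    have hR0 : ind P (hR 0) = ind P (MeasurableSet.iUnion hf) := by
      congr 1
      simp [R]
    have hlim := hcont R hR (fun n k hnk ω h => by
      obtain ⟨i, hi, h'⟩ := (hRmem _ _).1 h
      exact (hRmem _ _).2 ⟨i, hnk.trans hi, h'⟩) (by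
      refine Set.eq_empty_of_forall_notMem fun ω hω => ?_
      rw [Set.mem_iInter] at hω
      obtain ⟨i, -, hi⟩ := (hRmem _ _).1 (hω 0)
      obtain ⟨j, hj, hj'⟩ := (hRmem _ _).1 (hω (i + 1))
      exact Set.disjoint_left.1 (hdisj (show i ≠ j by omega)) hi hj')
    simp_rw [hpartial, hR0]
    simpa using hlim.const_sub (φ (ind P (MeasurableSet.iUnion hf)))
  let P₀ : Measure Ω := Measure.ofMeasurable (fun A hA => ENNReal.ofReal (φ (ind P hA)))
    (by simp [ind_empty]) (fun f hf hdisj => by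
      have h := hsum f hf hdisj
      rw [← h.tsum_eq]
      exact ENNReal.ofReal_tsum_of_nonneg (fun i => hind (hf i)) h.summable)
  have hP₀ : ∀ {A : Set Ω} (hA : MeasurableSet A), P₀ A = ENNReal.ofReal (φ (ind P hA)) :=
    fun hA => Measure.ofMeasurable_apply _ hA
  have hprob : IsProbabilityMeasure P₀ := by
    refine ⟨?_⟩
    have hu : ind P MeasurableSet.univ = one P := indicatorConstLp_univ ..
    rw [hP₀ MeasurableSet.univ, hu, hφ1, ENNReal.ofReal_one]
  have hac : P₀ ≪ P := by
    refine Measure.AbsolutelyContinuous.mk fun A hA hPA => ?_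
    have h0 : ind P hA = 0 := by
      refine Lp.ext ?_
      filter_upwards [coeFn_ind (P := P) hA, Lp.coeFn_zero ℝ ∞ P,
        measure_eq_zero_iff_ae_notMem.1 hPA] with ω h₁ h₂ h₃
      rw [h₁, h₂, Set.indicator_of_notMem h₃, Pi.zero_apply]
    rw [hP₀ hA, h0, map_zero, ENNReal.ofReal_zero]
  refine ⟨P₀, hprob, hac, fun X => ?_⟩
  refine map_eq_of_map_ind_eq (𝒜 := mΩ) le_rfl (fun X hX => hφ X hX.2)
    (fun X hX => integralFunctional_nonneg hac hX.2) (fun A hA => ?_)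
    (mem_Linf.2 (Lp.aestronglyMeasurable X))
  rw [integralFunctional_ind, measureReal_def, hP₀ hA, ENNReal.toReal_ofReal (hind hA)]

end

section

variable {Ω : Type*} {𝒜 : MeasurableSpace Ω} {mΩ : MeasurableSpace Ω}

/-! ### Conditional expectations -/

theorem ae_le_of_forall_setIntegral_le_of_le {μ : Measure Ω} [IsFiniteMeasure μ] (h𝒜 : 𝒜 ≤ mΩ)
    {g h : Ω → ℝ} (hg : AEStronglyMeasurable[𝒜] g μ) (hh : AEStronglyMeasurable[𝒜] h μ)
    (hgi : Integrable g μ) (hhi : Integrable h μ)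
    (hle : ∀ A, MeasurableSet[𝒜] A → ∫ ω in A, g ω ∂μ ≤ ∫ ω in A, h ω ∂μ) : g ≤ᵐ[μ] h := by
  obtain ⟨g', hg', hgg'⟩ := hg
  obtain ⟨h', hh', hhh'⟩ := hh
  have key : g' ≤ᵐ[μ.trim h𝒜] h' := by
    refine ae_le_of_forall_setIntegral_le ((hgi.congr hgg').trim h𝒜 hg')
      ((hhi.congr hhh').trim h𝒜 hh') fun A hA _ => ?_
    rw [← setIntegral_trim h𝒜 hg' hA, ← setIntegral_trim h𝒜 hh' hA]
    calc ∫ ω in A, g' ω ∂μ = ∫ ω in A, g ω ∂μ :=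
          integral_congr_ae (ae_restrict_of_ae hgg'.symm)
      _ ≤ ∫ ω in A, h ω ∂μ := hle A hA
      _ = ∫ ω in A, h' ω ∂μ := integral_congr_ae (ae_restrict_of_ae hhh')
  filter_upwards [hgg', hhh', ae_le_of_ae_le_trim key] with ω h₁ h₂ h₃
  rwa [h₁, h₂]

/-- Bayes' formula for conditional expectations under an equivalent change of measure. -/
theorem condExp_eq_condExp_mul_div {P P₀ : Measure Ω} [IsProbabilityMeasure P]
    [IsProbabilityMeasure P₀] (h : P₀ ≪ P) (h' : P ≪ P₀) (h𝒜 : 𝒜 ≤ mΩ) {f X : Ω → ℝ}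
    (hf : f =ᵐ[P] fun ω => (P₀.rnDeriv P ω).toReal) (hX : AEStronglyMeasurable X P) {C : ℝ}
    (hC : ∀ᵐ ω ∂P, |X ω| ≤ C) :
    Integrable (fun ω => X ω * (f ω / (P[f | 𝒜]) ω)) P ∧
      P₀[X | 𝒜] =ᵐ[P] P[fun ω => X ω * (f ω / (P[f | 𝒜]) ω) | 𝒜] := by
  set r : Ω → ℝ := fun ω => (P₀.rnDeriv P ω).toReal
  set k : Ω → ℝ := P[f | 𝒜]
  have hk : StronglyMeasurable[𝒜] k := stronglyMeasurable_condExp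
  have hkinv : StronglyMeasurable[𝒜] k⁻¹ := hk.measurable.inv.stronglyMeasurable
  set r' : Ω → ℝ := fun ω => ((P₀.trim h𝒜).rnDeriv (P.trim h𝒜) ω).toReal
  have htr : P₀.trim h𝒜 ≪ P.trim h𝒜 := h.trim h𝒜
  have hkr : r' =ᵐ[P.trim h𝒜] k := by
    have h1 : k =ᵐ[P.trim h𝒜] P[r | 𝒜] := by
      refine (StronglyMeasurable.ae_eq_trim_iff h𝒜 hk stronglyMeasurable_condExp).2 ?_
      exact condExp_congr_ae hf
    exact (toReal_rnDeriv_trim h𝒜 h).trans h1.symm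
  have hpos : ∀ᵐ ω ∂P.trim h𝒜, 0 < r' ω := by
    filter_upwards [Measure.rnDeriv_pos' (h'.trim h𝒜),
      Measure.rnDeriv_lt_top (P₀.trim h𝒜) (P.trim h𝒜)] with ω h₁ h₂
    exact ENNReal.toReal_pos h₁.ne' h₂.ne
  -- `1 / k` is integrable, since `E_{P₀}[1 / k] = E_P[k / k] = 1`
  have hcancel : ∀ᵐ ω ∂P.trim h𝒜, r' ω * k⁻¹ ω = 1 := by
    filter_upwards [hkr, hpos] with ω h₁ h₂
    rw [Pi.inv_apply, ← h₁, mul_inv_cancel₀ h₂.ne']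
  have hkint : Integrable k⁻¹ P₀ := by
    refine integrable_of_integrable_trim h𝒜 ((integrable_rnDeriv_smul_iff htr).1 ?_)
    refine (integrable_const (1 : ℝ)).congr ?_
    filter_upwards [hcancel] with ω h₁ using h₁.symm
  have hX₀ : AEStronglyMeasurable X P₀ := hX.mono_ac h
  have hC₀ : ∀ᵐ ω ∂P₀, |X ω| ≤ C := h.ae_le hC
  have hXint : Integrable X P₀ := Integrable.of_bound hX₀ C hC₀
  have hkX : Integrable (k⁻¹ * X) P₀ := hkint.mul_bdd hX₀ hC₀
  have heq : (fun ω => r ω • (k⁻¹ * X) ω) =ᵐ[P] fun ω => X ω * (f ω / k ω) := by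
    filter_upwards [hf] with ω h₁
    rw [h₁, smul_eq_mul, Pi.mul_apply, Pi.inv_apply, div_eq_mul_inv]
    ring
  have hint : Integrable (fun ω => X ω * (f ω / k ω)) P :=
    ((integrable_rnDeriv_smul_iff h).2 hkX).congr heq
  refine ⟨hint, ?_⟩
  have hcond : StronglyMeasurable[𝒜] (P₀[X | 𝒜]) := stronglyMeasurable_condExp
  have hcondC : ∀ᵐ ω ∂P, |(P₀[X | 𝒜]) ω| ≤ C := h'.ae_le (ae_bdd_abs_condExp_of_ae_bdd_abs hC₀)
  have hcondint : Integrable (P₀[X | 𝒜]) P :=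
    Integrable.of_bound (hcond.mono h𝒜).aestronglyMeasurable C hcondC
  refine ae_eq_condExp_of_forall_setIntegral_eq h𝒜 hint (fun _ _ _ => hcondint.integrableOn)
    (fun A hA _ => ?_) hcond.aestronglyMeasurable
  symm
  calc ∫ ω in A, X ω * (f ω / k ω) ∂P
      = ∫ ω in A, r ω • (k⁻¹ * X) ω ∂P := integral_congr_ae (ae_restrict_of_ae heq.symm)
    _ = ∫ ω in A, (k⁻¹ * X) ω ∂P₀ := setIntegral_rnDeriv_smul h (h𝒜 A hA)
    _ = ∫ ω in A, (P₀[k⁻¹ * X | 𝒜]) ω ∂P₀ := (setIntegral_condExp h𝒜 hkX hA).symm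
    _ = ∫ ω in A, (k⁻¹ * P₀[X | 𝒜]) ω ∂P₀ := integral_congr_ae (ae_restrict_of_ae
        (condExp_mul_of_stronglyMeasurable_left hkinv hkX hXint))
    _ = ∫ ω in A, (k⁻¹ * P₀[X | 𝒜]) ω ∂P₀.trim h𝒜 := setIntegral_trim h𝒜 (hkinv.mul hcond) hA
    _ = ∫ ω in A, r' ω • (k⁻¹ * P₀[X | 𝒜]) ω ∂P.trim h𝒜 :=
        (setIntegral_rnDeriv_smul htr hA).symm
    _ = ∫ ω in A, (P₀[X | 𝒜]) ω ∂P.trim h𝒜 := by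
        refine integral_congr_ae (ae_restrict_of_ae ?_)
        filter_upwards [hcancel] with ω h₁
        rw [smul_eq_mul, Pi.mul_apply, ← mul_assoc, h₁, one_mul]
    _ = ∫ ω in A, (P₀[X | 𝒜]) ω ∂P := (setIntegral_trim h𝒜 hcond hA).symm

end

end

end SandwichPricing

/-! ### The pricing measure -/

theorem mainTheorem1 {Ω : Type*} {mΩ : MeasurableSpace Ω} (P : Measure Ω)
    [IsProbabilityMeasure P] (T : ℝ) (hT : 0 < T)
    (𝓕 : Filtration (Set.Icc (0 : ℝ) T) mΩ) (h_right : 𝓕.IsRightContinuous)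
    (h_terminal : 𝓕 ⟨T, hT.le, le_rfl⟩ = mΩ)
    (M m : Set.Icc (0 : ℝ) T → Set.Icc (0 : ℝ) T → Lp ℝ ∞ P → Lp ℝ ∞ P)
    (hM : SandwichPricing.IsWeakConsistentSublinear P 𝓕 M)
    (hm : SandwichPricing.IsWeakConsistentSuperlinear P 𝓕 m)
    (hM_reg : ∀ s t, s ≤ t → SandwichPricing.IsRegular (𝓕 t) (M s t) ∨
      SandwichPricing.IsWeakStarContinuous (𝓕 s) (𝓕 t) (M s t))
    (hm_pos : ∀ X ∈ SandwichPricing.LinfPos (𝓕 ⟨T, hT.le, le_rfl⟩) P, 0 < X →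
      0 < m ⟨0, le_rfl, hT.le⟩ ⟨T, hT.le, le_rfl⟩ X)
    (hM_wrc : ∀ s t, s ≤ t → ∀ X ∈ SandwichPricing.LinfPos (𝓕 t) P,
      ∀ u, SandwichPricing.DecreasesTo u s → (∀ n, u n ≤ t) →
        ∀ᵐ ω ∂P, liminf (fun n => ((M (u n) t X ω : ℝ) : EReal)) atTop ≤ (M s t X ω : ℝ))
    (hm_wrc : ∀ s t, s ≤ t → ∀ X ∈ SandwichPricing.LinfPos (𝓕 t) P,
      ∀ u, SandwichPricing.DecreasesTo u s → (∀ n, u n ≤ t) →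
        ∀ᵐ ω ∂P, ((m s t X ω : ℝ) : EReal) ≤
          limsup (fun n => ((m (u n) t X ω : ℝ) : EReal)) atTop)
    (L : Set.Icc (0 : ℝ) T → Submodule ℝ (Lp ℝ ∞ P))
    (hL : SandwichPricing.IsMarket P 𝓕 L)
    (x : Set.Icc (0 : ℝ) T → Set.Icc (0 : ℝ) T → Lp ℝ ∞ P → Lp ℝ ∞ P)
    (hx : SandwichPricing.IsPriceFamily P 𝓕 L x)
    (h_sandwich : ∀ s t, s ≤ t → ∀ X ∈ L t, ∀ Y ∈ SandwichPricing.LinfPos (𝓕 t) P,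
      ∀ Z ∈ SandwichPricing.LinfPos (𝓕 t) P, Z + X ≤ Y → m s t Z + x s t X ≤ M s t Y) :
    ∃ (P₀ : Measure Ω) (f : Lp ℝ 1 P),
      IsProbabilityMeasure P₀ ∧ P₀ ≪ P ∧ P ≪ P₀ ∧
      0 ≤ f ∧
      (∀ A, MeasurableSet A → P₀.real A = ∫ ω in A, f ω ∂P) ∧
      P[f | 𝓕 ⟨0, le_rfl, hT.le⟩] =ᵐ[P] (fun _ => 1) ∧
      (∀ s t, s ≤ t → ∀ X ∈ SandwichPricing.LinfPos (𝓕 t) P,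
        m s t X ≤ᵐ[P] P₀[X | 𝓕 s] ∧ P₀[X | 𝓕 s] ≤ᵐ[P] M s t X) ∧
      (∀ s t, s ≤ t → ∀ X ∈ L t,
        x s t X =ᵐ[P] P₀[X | 𝓕 s] ∧
        Integrable (fun ω => X ω * (f ω / (P[f | 𝓕 s]) ω)) P ∧
        P₀[X | 𝓕 s] =ᵐ[P] P[fun ω => X ω * (f ω / (P[f | 𝓕 s]) ω) | 𝓕 s]) := by
  set o : Set.Icc (0 : ℝ) T := ⟨0, le_rfl, hT.le⟩
  set e : Set.Icc (0 : ℝ) T := ⟨T, hT.le, le_rfl⟩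
  have ho : ∀ t, o ≤ t := fun t => t.2.1
  have he : ∀ t, t ≤ e := fun t => t.2.2
  have hS : ∀ s t, s ≤ t →
      SandwichPricing.IsSandwich (𝓕 s) (𝓕 t) (L t) (M s t) (m s t) (x s t) := fun s t hst =>
    { le_left_right := 𝓕.mono hst
      le_right := 𝓕.le t
      maps_to_M := hM.maps_to s t hst
      sublinear := hM.sublinear s t hst
      homogeneous_M := hM.homogeneous s t hst
      maps_to_m := hm.maps_to s t hst
      superlinear := hm.superlinear s t hst
      homogeneous_m := hm.homogeneous s t hst
      price := hx.price s t hst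
      one_mem := hL.one_mem t
      sandwich := h_sandwich s t hst }
  obtain ⟨φ, hφo, hφ, hφc⟩ := SandwichPricing.exists_isCompatible ho h_terminal hS hL.le_Linf
    hM.comp_le hm.le_comp hx.maps_to (fun r s t hrs hst => hx.consistent r s t hrs hst)
    (SandwichPricing.integralFunctional (P := P) .rfl)
    (fun X hX => SandwichPricing.integralFunctional_nonneg .rfl hX.2)
  have hφo' : ∀ X ∈ SandwichPricing.Linf (𝓕 o) P, φ X = ∫ ω, X ω ∂P := hφo
  have hLT : SandwichPricing.LinfPos mΩ P = SandwichPricing.LinfPos (𝓕 e) P := by rw [h_terminal]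
  have hMT := hM.maps_to o e (ho e)
  have hMT_hom := hM.homogeneous o e (ho e)
  have hMT_reg := hM_reg o e (ho e)
  have hφM : ∀ X, 0 ≤ X → φ X ≤ φ (M o e X) := fun X hX =>
    (hφc o e (ho e)).upper X (hLT ▸ SandwichPricing.mem_LinfPos_top hX)
  have hMT0 : M o e 0 = 0 := by
    simpa using (hM.sublinear o e (ho e)).map_smul 0 SandwichPricing.mem_LinfPos_zero 0 le_rfl
  rw [h_terminal] at hMT_reg
  rw [← hLT] at hMT hMT_hom
  -- the functional is countably additive, hence the expectation under a probability measure
  have hone : φ (SandwichPricing.one P) = 1 := by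
    rw [hφo' _ SandwichPricing.one_mem_LinfPos.1]
    refine (integral_congr_ae SandwichPricing.coeFn_one).trans ?_
    simp
  have hcont : ∀ B : ℕ → Set Ω, ∀ hB : ∀ n, MeasurableSet (B n), Antitone B → ⋂ n, B n = ∅ →
      Tendsto (fun n => φ (SandwichPricing.ind P (hB n))) atTop (𝓝 0) := by
    intro B hB hanti hempty
    have hlim : ∀ᵐ ω ∂P, Tendsto (fun n => SandwichPricing.ind P (hB n) ω) atTop (𝓝 0) := by
      filter_upwards [ae_all_iff.2 fun n => SandwichPricing.coeFn_ind (P := P) (hB n)] with ω hω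
      have hω' : ω ∉ ⋂ n, B n := by simp [hempty]
      obtain ⟨N, hN⟩ := not_forall.1 (fun h => hω' (Set.mem_iInter.2 h))
      refine tendsto_const_nhds.congr' ?_
      filter_upwards [eventually_ge_atTop N] with n hn
      rw [hω, Set.indicator_of_notMem fun h => hN (hanti hn h)]
    have hle1 : ∀ n, SandwichPricing.ind P (hB n) ≤ SandwichPricing.one P := by
      intro n
      rw [← Lp.coeFn_le]
      filter_upwards [SandwichPricing.coeFn_ind (P := P) (hB n), SandwichPricing.coeFn_one (P := P)]
        with ω h₁ h₂
      rw [h₁, h₂]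
      exact Set.indicator_le_self' (fun _ _ => zero_le_one) ω
    have hX0 := fun n => SandwichPricing.ind_nonneg (P := P) (hB n)
    rcases hMT_reg with hreg | hws
    · refine hreg.tendsto_map_zero (𝓕.le o) hMT hMT_hom hφ hφo' hφM hX0 hle1 ?_ hlim
      intro n k hnk
      rw [← Lp.coeFn_le]
      filter_upwards [SandwichPricing.coeFn_ind (P := P) (hB n),
        SandwichPricing.coeFn_ind (P := P) (hB k)] with ω h₁ h₂
      rw [h₁, h₂]
      exact Set.indicator_le_indicator_of_subset (hanti hnk) (fun _ => zero_le_one) ω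
    · exact hws.tendsto_map_zero hMT hMT0 hφ hφo' hφM hX0 hle1 hlim
  obtain ⟨P₀, hP₀, hac, hφP₀⟩ := SandwichPricing.exists_measure_eq_integral hφ hone hcont
  have hset : ∀ A (hA : MeasurableSet A), ∀ X : Lp ℝ ∞ P,
      φ (SandwichPricing.mul (SandwichPricing.ind P hA) X) = ∫ ω in A, X ω ∂P₀ := fun A hA X => by
    rw [hφP₀, SandwichPricing.integralFunctional_ind_mul]
  have hac' : P ≪ P₀ := by
    refine Measure.AbsolutelyContinuous.mk fun A hA hA0 => ?_
    by_contra hPA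
    have hI := SandwichPricing.ind_nonneg (P := P) hA
    have hImem : SandwichPricing.ind P hA ∈ SandwichPricing.LinfPos (𝓕 e) P :=
      hLT ▸ SandwichPricing.mem_LinfPos_top hI
    have hIne : SandwichPricing.ind P hA ≠ 0 := by
      intro h
      have h1 := SandwichPricing.integralFunctional_ind (P := P) (μ := P) .rfl hA
      rw [h, map_zero] at h1
      exact hPA ((measureReal_eq_zero_iff (measure_ne_top _ _)).1 h1.symm)
    have hmpos := hm_pos _ hImem (lt_of_le_of_ne hI hIne.symm)
    have hlow := (hφc o e (ho e)).lower _ hImem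
    have hφI : φ (SandwichPricing.ind P hA) = 0 := by
      rw [hφP₀, SandwichPricing.integralFunctional_ind, measureReal_def, hA0, ENNReal.toReal_zero]
    rw [hφI, hφo' _ (hm.maps_to o e (ho e) hImem).1] at hlow
    have hint := SandwichPricing.integrable_coeFn (m o e (SandwichPricing.ind P hA))
      (μ := P) .rfl
    have hnn := (Lp.coeFn_nonneg _).2 hmpos.le
    have hzero := (integral_eq_zero_iff_of_nonneg_ae hnn hint).1
      (le_antisymm hlow (integral_nonneg_of_ae hnn))
    refine hmpos.ne' (Lp.ext ?_)
    exact hzero.trans (Lp.coeFn_zero ℝ ∞ P).symm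
  set r : Ω → ℝ := fun ω => (P₀.rnDeriv P ω).toReal
  have hr : Integrable r P := Measure.integrable_toReal_rnDeriv
  have hrm : MemLp r 1 P := memLp_one_iff_integrable.2 hr
  have hf : ⇑(hrm.toLp r) =ᵐ[P] r := hrm.coeFn_toLp
  have hfA : ∀ A, P₀.real A = ∫ ω in A, hrm.toLp r ω ∂P := fun A => by
    rw [← Measure.setIntegral_toReal_rnDeriv hac A]
    exact integral_congr_ae (ae_restrict_of_ae hf.symm)
  refine ⟨P₀, hrm.toLp r, hP₀, hac, hac', ?_, fun A _ => hfA A, ?_, fun s t hst X hX => ?_,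
    fun s t hst X hX => ?_⟩
  · rw [← Lp.coeFn_nonneg]
    filter_upwards [hf] with ω h
    rw [h]
    exact ENNReal.toReal_nonneg
  · refine (ae_eq_condExp_of_forall_setIntegral_eq (𝓕.le o) (L1.integrable_coeFn _)
      (fun _ _ _ => (integrable_const _).integrableOn) (fun A hA _ => ?_)
      aestronglyMeasurable_const).symm
    have hA' := 𝓕.le o A hA
    rw [← hfA A, ← SandwichPricing.integralFunctional_ind hac hA', ← hφP₀,
      hφo _ (SandwichPricing.ind_mem_LinfPos (𝓕.le o) hA).1,
      SandwichPricing.integralFunctional_ind]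
    simp
  · have hc := hφc s t hst
    have hXi := SandwichPricing.integrable_coeFn X hac
    have hI : ∀ A, ∀ hA : MeasurableSet[𝓕 s] A, SandwichPricing.mul
        (SandwichPricing.ind P (𝓕.le s A hA)) X ∈ SandwichPricing.LinfPos (𝓕 t) P := fun A hA =>
      SandwichPricing.mul_mem_LinfPos (SandwichPricing.LinfPos_mono (𝓕.mono hst)
        (SandwichPricing.ind_mem_LinfPos (𝓕.le s) hA)) hX
    have hmX := SandwichPricing.mem_Linf.1 (hm.maps_to s t hst hX).1
    have hMX := SandwichPricing.mem_Linf.1 (hM.maps_to s t hst hX).1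
    constructor
    · refine hac'.ae_le (SandwichPricing.ae_le_of_forall_setIntegral_le_of_le (𝓕.le s)
        (hmX.mono_ac hac) stronglyMeasurable_condExp.aestronglyMeasurable
        (SandwichPricing.integrable_coeFn _ hac) integrable_condExp fun A hA => ?_)
      rw [setIntegral_condExp (𝓕.le s) hXi hA, ← hset A (𝓕.le s A hA), ← hset A (𝓕.le s A hA),
        ← hm.homogeneous s t hst X hX _ (SandwichPricing.ind_mem_LinfPos (𝓕.le s) hA) (hI A hA)]
      exact hc.lower _ (hI A hA)
    · refine hac'.ae_le (SandwichPricing.ae_le_of_forall_setIntegral_le_of_le (𝓕.le s)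
        stronglyMeasurable_condExp.aestronglyMeasurable (hMX.mono_ac hac)
        integrable_condExp (SandwichPricing.integrable_coeFn _ hac) fun A hA => ?_)
      rw [setIntegral_condExp (𝓕.le s) hXi hA, ← hset A (𝓕.le s A hA), ← hset A (𝓕.le s A hA),
        ← hM.homogeneous s t hst X hX _ (SandwichPricing.ind_mem_LinfPos (𝓕.le s) hA) (hI A hA)]
      exact hc.upper _ (hI A hA)
  · have hxX := SandwichPricing.mem_Linf.1 ((hx.price s t hst).maps_to X hX)
    refine ⟨hac'.ae_le (ae_eq_condExp_of_forall_setIntegral_eq (𝓕.le s)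
      (SandwichPricing.integrable_coeFn X hac)
      (fun _ _ _ => (SandwichPricing.integrable_coeFn _ hac).integrableOn) (fun A hA _ => ?_)
      (hxX.mono_ac hac)), ?_⟩
    · rw [← hset A (𝓕.le s A hA), ← hset A (𝓕.le s A hA)]
      exact ((hφc s t hst).price A hA (𝓕.le s A hA) X hX).symm
    · exact SandwichPricing.condExp_eq_condExp_mul_div hac hac' (𝓕.le s) hf
        (Lp.aestronglyMeasurable X) (SandwichPricing.ae_abs_le_norm X)
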